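/- Let $T>0$ and $\Omega=[0,1]\times[0,T]$. Call a function $f$ on $\Omega$ *completely continuous with square integrable densities* if $f(x,t)=f(0,0)+\int_0^x a(y)\,dy+\int_0^t b(s)\,ds+\int_0^x\!\int_0^t c(y,s)\,ds\,dy$ on $\Omega$ with $a\in L^2[0,1]$, $b\in L^2[0,T]$, $c\in L^2(\Omega)$; then $a=\partial_x f(\cdot,0)$, $b=\partial_t f(0,\cdot)$ and $c=\partial_x\partial_t f$ almost everywhere. Let $\widehat W(\Omega)$ be the Hilbert space of all such functions with $$\langle f,g\rangle_{\widehat W}=\int_0^T \partial_t f(0,t)\,\partial_t g(0,t)\,dt+f(0,0)g(0,0)+\int_0^1\partial_xf(x,0)\,\partial_xg(x,0)\,dx+\int_0^1\!\int_0^T\partial_x\partial_tf\;\partial_x\partial_tg\,dt\,dx .$$ Its reproducing kernel is $G_{(y,s)}(x,t)=(1+\min(x,y))(1+\min(t,s))$. Let $W(\Omega)$ be the Hilbert space of all functions $u$ on $\Omega$ whose partial derivatives $\partial_x^i\partial_t^j u$, $i,j\le 2$, exist, such that $\partial_x^2\partial_t^2u$ is completely continuous with square integrable densities (so that $\partial_x^3\partial_t^3u\in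 L^2(\Omega)$), and such that $u(x,0)=\partial_tu(x,0)=u(0,t)=u(1,t)=0$ for $0\le x\le 1$, $0\le t\le T$, with the inner product $$\langle u,g\rangle_W=\sum_{i=0}^2\int_0^T\partial_t^3\partial_x^iu(0,t)\,\partial_t^3\partial_x^ig(0,t)\,dt+\sum_{j=0}^2\big\langle\partial_t^ju(\cdot,0),\partial_t^jg(\cdot,0)\big\rangle_{W_2^3}+\int_0^1\!\int_0^T\partial_x^3\partial_t^3u\;\partial_x^3\partial_t^3g\,dt\,dx,$$ where $\langle h,k\rangle_{W_2^3}=h(0)k(0)+h'(0)k'(0)+h'(1)k'(1)+\int_0^1h'''k'''\,dx$. Let $L:W(\Omega)\to\widehat W(\Omega)$ be the bounded linear operator $Lu=\partial_t^2u-\partial_x^2u$ and $L^*$ its adjoint. Let $(x_i,t_i)_{i\ge1}$ be a sequence of points of $\Omega$ that is dense in $\Omega$, put $\Psi_i=L^*G_{(x_i,t_i)}\in W(\Omega)$, and let $(\widehat\Psi_i)_{i\ge1}$ be obtained from $(\Psi_i)_{i\ge1}$ by Gram–Schmidt orthonormalisation in $W(\Omega)$, where $\widehat\Psi_i=0$ if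 $\Psi_i$ is a linear combination of $\Psi_1,\dots,\Psi_{i-1}$. Then there are real numbers $\beta_{ik}$, $1\le k\le i$, with $\widehat\Psi_i=\sum_{k=1}^i\beta_{ik}\Psi_k$ for all $i$, and for every such choice of the $\beta_{ik}$ the following holds. Let $M:[0,1]\times[0,T]\times\mathbb R\to\mathbb R$ be a function and let $u\in W(\Omega)$ be a solution of the problem $$Lu(x,t)=M(x,t,u(x,t)),\quad (x,t)\in\Omega,\qquad u(x,0)=\partial_tu(x,0)=u(0,t)=u(1,t)=0 .$$ Then $$u(x,t)=\sum_{i=1}^\infty\Big(\sum_{k=1}^i\beta_{ik}\,M\big(x_k,t_k,u(x_k,t_k)\big)\Big)\widehat\Psi_i(x,t),$$ where the series converges unconditionally in the norm of $W(\Omega)$ and at every point of $\Omega$; in particular the truncations $u_n=\sum_{i=1}^n\sum_{k=1}^i\beta_{ik}M(x_k,t_k,u(x_k,t_k))\widehat\Psi_i$ satisfy $\|u_n-u\|_W\to0$ as $n\to\infty$. -/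

import Mathlib

open MeasureTheory Set Filter Topology

noncomputable section

namespace SGK

/-!
The notions in the statement: the rectangle `Omega`, the space `WHat T` with the inner product
`innerHat`, the space `W T` (membership `MemW`) with the inner product `innerW`, the bounded operator
`L : W T →L[ℝ] WHat T`, the reproducing kernel `kernel` of `WHat T`, `Psi` (the adjoint of `L` applied
to kernels), `PsiHat` (Gram-Schmidt), `IsSolution`, `IsCoeff`, `coeff`.

Everything marked as auxiliary, and every theorem, only serves to prove that these are well defined:
that `innerHat` and `innerW` are inner products, that both spaces are complete, that `L` maps into
`WHat T` and is bounded (so that its adjoint exists), and that the kernel belongs to `WHat T`.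
-/

/-- The closed rectangle `[0,1] × [0,T]`. -/
def Omega (T : ℝ) : Set (ℝ × ℝ) := Icc 0 1 ×ˢ Icc 0 T

/-- Membership in `W_2^1[0,S]`: absolutely continuous on `[0,S]` with derivative in `L²[0,S]`
(`deriv f` exists almost everywhere). Only the values of `f` on `[0,S]` matter. -/
def MemW21 (S : ℝ) (f : ℝ → ℝ) : Prop :=
  AbsolutelyContinuousOnInterval f 0 S ∧ MemLp (deriv f) 2 (volume.restrict (Icc 0 S))

/-- The inner product of `W_2^1[0,S]`. -/
def innerW21 (S : ℝ) (f g : ℝ → ℝ) : ℝ :=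
  f 0 * g 0 + ∫ x in (0 : ℝ)..S, deriv f x * deriv g x

/-- Auxiliary: `f` is on `[0,S]` a primitive of the `L²` function `g`. -/
def Rep (S : ℝ) (f g : ℝ → ℝ) : Prop :=
  MemLp g 2 (volume.restrict (Icc 0 S)) ∧ ∀ t ∈ Icc 0 S, f t = f 0 + ∫ s in (0 : ℝ)..t, g s

theorem intInt {S : ℝ} {g : ℝ → ℝ} (hg : MemLp g 2 (volume.restrict (Icc 0 S))) {t : ℝ}
    (ht : t ∈ Icc 0 S) : IntervalIntegrable g volume 0 t := by
  have h1 : IntegrableOn g (Icc 0 S) := hg.integrable one_le_two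
  rw [intervalIntegrable_iff_integrableOn_Icc_of_le ht.1]
  exact h1.mono_set (Icc_subset_Icc_right ht.2)

theorem MemW21.rep {S : ℝ} {f : ℝ → ℝ} (hf : MemW21 S f) : Rep S f (deriv f) := by
  refine ⟨hf.2, fun t ht => ?_⟩
  have h := (hf.1.mono (c := 0) (d := t) (by
    rw [uIcc_of_le ht.1, uIcc_of_le (ht.1.trans ht.2)]
    exact Icc_subset_Icc_right ht.2)).integral_deriv_eq_sub
  rw [h]; ring

theorem ac_congr {S : ℝ} {f g : ℝ → ℝ} (hf : AbsolutelyContinuousOnInterval f 0 S)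
    (h : EqOn f g (uIcc 0 S)) : AbsolutelyContinuousOnInterval g 0 S := by
  rw [absolutelyContinuousOnInterval_iff] at hf ⊢
  intro ε hε
  obtain ⟨δ, hδ, H⟩ := hf ε hε
  refine ⟨δ, hδ, fun E hE hl => ?_⟩
  have := H E hE hl
  convert this using 1
  refine Finset.sum_congr rfl fun i hi => ?_
  have hm := hE.1 i hi
  rw [h hm.1, h hm.2]

theorem Rep.memW21 {S : ℝ} (hS : 0 ≤ S) {f g : ℝ → ℝ} (h : Rep S f g) :
    MemW21 S f ∧ deriv f =ᵐ[volume.restrict (Icc 0 S)] g := by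
  have hi := intInt h.1 (right_mem_Icc.2 hS)
  have hae : deriv f =ᵐ[volume.restrict (Icc 0 S)] g := by
    have h0 := hi.ae_hasDerivAt_integral
    rw [uIcc_of_le hS] at h0
    rw [← restrict_Ioo_eq_restrict_Icc]
    rw [Filter.EventuallyEq, ae_restrict_iff' measurableSet_Ioo]
    filter_upwards [h0] with x hx hxm
    have h1 := (hx (Ioo_subset_Icc_self hxm) 0 (left_mem_Icc.2 hS)).const_add (f 0)
    refine (h1.congr_of_eventuallyEq ?_).deriv
    filter_upwards [Ioo_mem_nhds hxm.1 hxm.2] with y hy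
    exact h.2 y (Ioo_subset_Icc_self hy)
  refine ⟨⟨?_, h.1.ae_eq hae.symm⟩, hae⟩
  have h1 := hi.absolutelyContinuousOnInterval_intervalIntegral (c := 0) left_mem_uIcc
  have h2 : AbsolutelyContinuousOnInterval (fun _ : ℝ => f 0) 0 S :=
    (LipschitzWith.const (f 0)).lipschitzOnWith.absolutelyContinuousOnInterval
  refine ac_congr (h2.add h1) fun t ht => ?_
  rw [uIcc_of_le hS] at ht
  simpa using (h.2 t ht).symm

theorem Rep.add {S : ℝ} {f g f' g' : ℝ → ℝ} (h : Rep S f g) (h' : Rep S f' g') :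
    Rep S (fun x => f x + f' x) (fun x => g x + g' x) := by
  refine ⟨h.1.add h'.1, fun t ht => ?_⟩
  beta_reduce
  rw [intervalIntegral.integral_add (intInt h.1 ht) (intInt h'.1 ht), h.2 t ht, h'.2 t ht]
  ring

theorem Rep.smul {S : ℝ} {f g : ℝ → ℝ} (c : ℝ) (h : Rep S f g) :
    Rep S (fun x => c * f x) (fun x => c * g x) := by
  refine ⟨h.1.const_mul c, fun t ht => ?_⟩
  beta_reduce
  rw [intervalIntegral.integral_const_mul, h.2 t ht]
  ring

theorem Rep.congr {S : ℝ} {f g f' : ℝ → ℝ} (h : Rep S f g)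
    (h' : ∀ t ∈ Icc 0 S, f' t = f t) : Rep S f' g := by
  refine ⟨h.1, fun t ht => ?_⟩
  rw [h' t ht, h' 0 ⟨le_rfl, ht.1.trans ht.2⟩, h.2 t ht]

theorem Rep.continuousOn {S : ℝ} {f g : ℝ → ℝ} (hS : 0 ≤ S) (h : Rep S f g) :
    ContinuousOn f (Icc 0 S) := by
  simpa [uIcc_of_le hS] using (h.memW21 hS).1.1.continuousOn

theorem ae_zero_of_int {S : ℝ} (hS : 0 ≤ S) {g : ℝ → ℝ} (hg : IntegrableOn g (Icc 0 S))
    (h : ∀ t ∈ Icc 0 S, ∫ s in (0 : ℝ)..t, g s = 0) : g =ᵐ[volume.restrict (Icc 0 S)] 0 := by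
  have hi : IntervalIntegrable g volume 0 S := by
    rwa [intervalIntegrable_iff_integrableOn_Icc_of_le hS]
  have h0 := hi.ae_hasDerivAt_integral
  rw [uIcc_of_le hS] at h0
  rw [← restrict_Ioo_eq_restrict_Icc]
  rw [Filter.EventuallyEq, ae_restrict_iff' measurableSet_Ioo]
  filter_upwards [h0] with x hx hxm
  have h1 := (hx (Ioo_subset_Icc_self hxm) 0 (left_mem_Icc.2 hS))
  have h2 : HasDerivAt (fun x => ∫ t in (0 : ℝ)..x, g t) 0 x := by
    refine (hasDerivAt_const x (0 : ℝ)).congr_of_eventuallyEq ?_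
    filter_upwards [Ioo_mem_nhds hxm.1 hxm.2] with y hy
    exact h y (Ioo_subset_Icc_self hy)
  exact h1.unique h2

/-- `c ∈ L²(Ω)` is the mixed derivative `∂²f/∂x∂t`, i.e. the density of the rectangle increments of
`f`. It is unique almost everywhere. -/
def IsMixed (T : ℝ) (f : ℝ → ℝ → ℝ) (c : ℝ × ℝ → ℝ) : Prop :=
  MemLp c 2 (volume.restrict (Omega T)) ∧
    ∀ x ∈ Icc (0 : ℝ) 1, ∀ t ∈ Icc 0 T,
      f x t - f x 0 - f 0 t + f 0 0 = ∫ y in (0 : ℝ)..x, ∫ s in (0 : ℝ)..t, c (y, s)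

/-- `f` is completely (absolutely) continuous on `Ω = [0,1] × [0,T]` in the sense of Carathéodory,
`f(x,t) = f(0,0) + ∫₀ˣ a + ∫₀ᵗ b + ∫₀ˣ∫₀ᵗ c`, with densities `a = ∂f/∂x(·,0)`, `b = ∂f/∂t(0,·)`,
`c = ∂²f/∂x∂t` that are square integrable. -/
def MemAC2 (T : ℝ) (f : ℝ → ℝ → ℝ) : Prop :=
  MemW21 1 (fun x => f x 0) ∧ MemW21 T (f 0) ∧ ∃ c, IsMixed T f c

open Classical in
/-- The mixed derivative `∂²f/∂x∂t` as an (almost everywhere defined) function on `Ω`. -/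
def dxt (T : ℝ) (f : ℝ → ℝ → ℝ) : ℝ × ℝ → ℝ :=
  if h : ∃ c, IsMixed T f c then h.choose else 0

/-- Auxiliary: `f` has the densities `a`, `b`, `c`. -/
structure Rep2 (T : ℝ) (f : ℝ → ℝ → ℝ) (a b : ℝ → ℝ) (c : ℝ × ℝ → ℝ) : Prop where
  ra : Rep 1 (fun x => f x 0) a
  rb : Rep T (f 0) b
  rc : IsMixed T f c

theorem MemAC2.rep {T : ℝ} {f : ℝ → ℝ → ℝ} (h : MemAC2 T f) :
    Rep2 T f (deriv fun x => f x 0) (deriv (f 0)) (dxt T f) := by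
  refine ⟨h.1.rep, h.2.1.rep, ?_⟩
  rw [dxt, dif_pos h.2.2]
  exact h.2.2.choose_spec

theorem restrict_Omega (T : ℝ) : (volume : Measure (ℝ × ℝ)).restrict (Omega T) =
    (volume.restrict (Icc (0 : ℝ) 1)).prod (volume.restrict (Icc 0 T)) := by
  rw [Omega, Measure.prod_restrict]; rfl

instance (T : ℝ) : IsFiniteMeasure ((volume : Measure (ℝ × ℝ)).restrict (Omega T)) := by
  rw [restrict_Omega]; infer_instance

theorem dbl {T : ℝ} {c : ℝ × ℝ → ℝ} (hc : IntegrableOn c (Omega T)) {x t : ℝ}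
    (hx : x ∈ Icc (0 : ℝ) 1) (ht : t ∈ Icc 0 T) :
    ∫ y in (0 : ℝ)..x, ∫ s in (0 : ℝ)..t, c (y, s) = ∫ z in Ioc 0 x ×ˢ Ioc 0 t, c z := by
  have hsub : Ioc 0 x ×ˢ Ioc 0 t ⊆ Omega T :=
    prod_mono (Ioc_subset_Icc_self.trans (Icc_subset_Icc_right hx.2))
      (Ioc_subset_Icc_self.trans (Icc_subset_Icc_right ht.2))
  have := setIntegral_prod (μ := (volume : Measure ℝ)) (ν := (volume : Measure ℝ)) c (hc.mono_set hsub)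
  rw [Measure.volume_eq_prod, this, intervalIntegral.integral_of_le hx.1]
  refine integral_congr_ae (Eventually.of_forall fun y => ?_)
  exact intervalIntegral.integral_of_le ht.1

theorem dbl_full {T : ℝ} (hT : 0 ≤ T) {c : ℝ × ℝ → ℝ} (hc : IntegrableOn c (Omega T)) :
    ∫ y in (0 : ℝ)..1, ∫ s in (0 : ℝ)..T, c (y, s) = ∫ z in Omega T, c z := by
  rw [restrict_Omega, integral_prod _ (by rw [← restrict_Omega]; exact hc),
    intervalIntegral.integral_of_le zero_le_one, ← integral_Icc_eq_integral_Ioc]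
  refine integral_congr_ae (Eventually.of_forall fun y => ?_)
  beta_reduce
  rw [intervalIntegral.integral_of_le hT, ← integral_Icc_eq_integral_Ioc]

theorem intOmega {T : ℝ} {c : ℝ × ℝ → ℝ} (hc : MemLp c 2 (volume.restrict (Omega T))) :
    IntegrableOn c (Omega T) := hc.integrable one_le_two

theorem subOmega {T x t : ℝ} (hx : x ∈ Icc (0 : ℝ) 1) (ht : t ∈ Icc 0 T) :
    Ioc 0 x ×ˢ Ioc 0 t ⊆ Omega T :=
  prod_mono (Ioc_subset_Icc_self.trans (Icc_subset_Icc_right hx.2))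
      (Ioc_subset_Icc_self.trans (Icc_subset_Icc_right ht.2))

theorem IsMixed.add {T : ℝ} {f g : ℝ → ℝ → ℝ} {c d : ℝ × ℝ → ℝ} (hf : IsMixed T f c)
    (hg : IsMixed T g d) : IsMixed T (fun x t => f x t + g x t) (fun z => c z + d z) := by
  refine ⟨hf.1.add hg.1, fun x hx t ht => ?_⟩
  have h1 := hf.2 x hx t ht
  have h2 := hg.2 x hx t ht
  rw [dbl (intOmega hf.1) hx ht] at h1
  rw [dbl (intOmega hg.1) hx ht] at h2
  rw [dbl (c := fun z => c z + d z) (intOmega (hf.1.add hg.1)) hx ht,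
    integral_add ((intOmega hf.1).mono_set (subOmega hx ht))
      ((intOmega hg.1).mono_set (subOmega hx ht)), ← h1, ← h2]
  ring

theorem IsMixed.smul {T : ℝ} {f : ℝ → ℝ → ℝ} {c : ℝ × ℝ → ℝ} (r : ℝ) (hf : IsMixed T f c) :
    IsMixed T (fun x t => r * f x t) (fun z => r * c z) := by
  refine ⟨hf.1.const_mul r, fun x hx t ht => ?_⟩
  have h1 := hf.2 x hx t ht
  simp only [intervalIntegral.integral_const_mul]
  rw [← h1]; ring

theorem IsMixed.congr {T : ℝ} {f g : ℝ → ℝ → ℝ} {c : ℝ × ℝ → ℝ} (hf : IsMixed T f c)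
    (h : ∀ x ∈ Icc (0 : ℝ) 1, ∀ t ∈ Icc 0 T, g x t = f x t) : IsMixed T g c := by
  refine ⟨hf.1, fun x hx t ht => ?_⟩
  have h0 : (0 : ℝ) ∈ Icc (0 : ℝ) 1 := by simp
  have h0' : (0 : ℝ) ∈ Icc (0 : ℝ) T := ⟨le_rfl, ht.1.trans ht.2⟩
  rw [h x hx t ht, h x hx 0 h0', h 0 h0 t ht, h 0 h0 0 h0', hf.2 x hx t ht]

theorem ae_zero_of_dbl {T : ℝ} (hT : 0 ≤ T) {c : ℝ × ℝ → ℝ} (hc : IntegrableOn c (Omega T))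
    (h : ∀ x ∈ Icc (0 : ℝ) 1, ∀ t ∈ Icc 0 T, ∫ y in (0 : ℝ)..x, ∫ s in (0 : ℝ)..t, c (y, s) = 0) :
    c =ᵐ[volume.restrict (Omega T)] 0 := by
  have hc' : Integrable c ((volume.restrict (Icc (0 : ℝ) 1)).prod (volume.restrict (Icc 0 T))) := by
    rw [← restrict_Omega]; exact hc
  obtain ⟨D, hDc, hDd⟩ := TopologicalSpace.exists_countable_dense (Icc 0 T)
  have h1 : ∀ t ∈ D, ∀ᵐ y ∂(volume.restrict (Icc (0 : ℝ) 1)), ∫ s in (0 : ℝ)..t, c (y, s) = 0 := by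
    intro t _
    refine ae_zero_of_int zero_le_one ?_ fun x hx => h x hx t t.2
    have h2 : Integrable c ((volume.restrict (Icc (0 : ℝ) 1)).prod
        (volume.restrict (Ioc 0 (t : ℝ)))) := by
      refine hc'.mono_measure (Measure.prod_mono le_rfl (Measure.restrict_mono ?_ le_rfl))
      exact Ioc_subset_Icc_self.trans (Icc_subset_Icc_right t.2.2)
    refine h2.integral_prod_left.congr (Eventually.of_forall fun y => ?_)
    exact (intervalIntegral.integral_of_le t.2.1).symm
  have h3 := (ae_ball_iff hDc).2 h1
  have h4 : ∀ᵐ y ∂(volume.restrict (Icc (0 : ℝ) 1)), ∀ᵐ s ∂(volume.restrict (Icc (0 : ℝ) T)),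
      c (y, s) = 0 := by
    filter_upwards [h3, hc'.prod_right_ae] with y hy hyi
    refine ae_zero_of_int hT hyi fun t ht => ?_
    have hcont : ContinuousOn (fun t => ∫ s in (0 : ℝ)..t, c (y, s)) (Icc 0 T) := by
      have := intervalIntegral.continuousOn_primitive_interval (f := fun s => c (y, s))
        (μ := volume) (a := 0) (b := T) (by rw [uIcc_of_le hT]; exact hyi)
      rwa [uIcc_of_le hT] at this
    have := Continuous.ext_on hDd (continuousOn_iff_continuous_domRestrict.1 hcont)
      (continuous_const (y := (0 : ℝ))) (fun t ht => hy t ht)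
    exact congrFun this ⟨t, ht⟩
  have h5 : ∫ z in Omega T, ‖c z‖ = 0 := by
    rw [restrict_Omega, integral_prod _ hc'.norm]
    rw [integral_congr_ae (g := fun _ => (0 : ℝ)), integral_zero]
    filter_upwards [h4] with y hy
    rw [integral_congr_ae (g := fun _ => (0 : ℝ)), integral_zero]
    filter_upwards [hy] with s hs
    simp [hs]
  rw [integral_eq_zero_iff_of_nonneg (fun _ => norm_nonneg _) hc.norm] at h5
  filter_upwards [h5] with z hz
  simpa using hz

theorem IsMixed.unique {T : ℝ} (hT : 0 ≤ T) {f : ℝ → ℝ → ℝ} {c d : ℝ × ℝ → ℝ} (hc : IsMixed T f c)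
    (hd : IsMixed T f d) : c =ᵐ[volume.restrict (Omega T)] d := by
  have h1 := (hc.add (hd.smul (-1)))
  have := ae_zero_of_dbl hT (intOmega h1.1) (fun x hx t ht => by rw [← h1.2 x hx t ht]; ring)
  filter_upwards [this] with z hz
  simp only [Pi.zero_apply] at hz
  linarith

theorem Rep2.memAC2 {T : ℝ} (hT : 0 ≤ T) {f : ℝ → ℝ → ℝ} {a b : ℝ → ℝ} {c : ℝ × ℝ → ℝ}
    (h : Rep2 T f a b c) : MemAC2 T f :=
  ⟨(h.ra.memW21 zero_le_one).1, (h.rb.memW21 hT).1, c, h.rc⟩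

theorem Rep2.dxt {T : ℝ} (hT : 0 ≤ T) {f : ℝ → ℝ → ℝ} {a b : ℝ → ℝ} {c : ℝ × ℝ → ℝ}
    (h : Rep2 T f a b c) : dxt T f =ᵐ[volume.restrict (Omega T)] c :=
  (h.memAC2 hT).rep.rc.unique hT h.rc

theorem Rep2.add {T : ℝ} {f f' : ℝ → ℝ → ℝ} {a b a' b' : ℝ → ℝ} {c c' : ℝ × ℝ → ℝ}
    (h : Rep2 T f a b c) (h' : Rep2 T f' a' b' c') :
    Rep2 T (fun x t => f x t + f' x t) (fun x => a x + a' x) (fun x => b x + b' x)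
      (fun x => c x + c' x) :=
  ⟨h.ra.add h'.ra, h.rb.add h'.rb, h.rc.add h'.rc⟩

theorem Rep2.smul {T : ℝ} {f : ℝ → ℝ → ℝ} {a b : ℝ → ℝ} {c : ℝ × ℝ → ℝ} (r : ℝ)
    (h : Rep2 T f a b c) :
    Rep2 T (fun x t => r * f x t) (fun x => r * a x) (fun x => r * b x) (fun x => r * c x) :=
  ⟨h.ra.smul r, h.rb.smul r, h.rc.smul r⟩

theorem Rep2.congr {T : ℝ} (hT : 0 ≤ T) {f g : ℝ → ℝ → ℝ} {a b : ℝ → ℝ} {c : ℝ × ℝ → ℝ}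
    (h : Rep2 T f a b c)
    (e : ∀ x ∈ Icc (0 : ℝ) 1, ∀ t ∈ Icc 0 T, g x t = f x t) : Rep2 T g a b c :=
  ⟨h.ra.congr fun x hx => e x hx 0 ⟨le_rfl, hT⟩, h.rb.congr fun t ht => e 0 (by simp) t ht,
    h.rc.congr e⟩

theorem MemAC2.congr {T : ℝ} (hT : 0 ≤ T) {f g : ℝ → ℝ → ℝ} (h : MemAC2 T f)
    (e : ∀ x ∈ Icc (0 : ℝ) 1, ∀ t ∈ Icc 0 T, g x t = f x t) : MemAC2 T g :=
  (h.rep.congr hT e).memAC2 hT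

theorem MemAC2.add {T : ℝ} (hT : 0 ≤ T) {f g : ℝ → ℝ → ℝ} (h : MemAC2 T f) (h' : MemAC2 T g) :
    MemAC2 T (fun x t => f x t + g x t) := (h.rep.add h'.rep).memAC2 hT

theorem MemAC2.smul {T : ℝ} (hT : 0 ≤ T) {f : ℝ → ℝ → ℝ} (r : ℝ) (h : MemAC2 T f) :
    MemAC2 T (fun x t => r * f x t) := (h.rep.smul r).memAC2 hT

theorem continuousOn_dbl {T : ℝ} {c : ℝ × ℝ → ℝ} (hc : IntegrableOn c (Omega T)) :
    ContinuousOn (fun p : ℝ × ℝ => ∫ y in (0 : ℝ)..p.1, ∫ s in (0 : ℝ)..p.2, c (y, s))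
      (Omega T) := by
  have key : Continuous (fun p : ℝ × ℝ =>
      ∫ z in Omega T, (Ioc 0 p.1 ×ˢ Ioc 0 p.2).indicator c z) := by
    rw [continuous_iff_continuousAt]
    intro p
    refine tendsto_integral_filter_of_dominated_convergence (fun z => ‖c z‖) ?_ ?_ hc.norm ?_
    · exact Eventually.of_forall fun q => hc.1.indicator (measurableSet_Ioc.prod measurableSet_Ioc)
    · exact Eventually.of_forall fun q => Eventually.of_forall fun z => norm_indicator_le_norm_self _ _
    · have hn : ∀ᵐ z : ℝ × ℝ, z.1 ≠ p.1 ∧ z.2 ≠ p.2 := by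
        have e1 : ∀ᵐ z : ℝ × ℝ, z.1 ≠ p.1 := by
          have := (Measure.quasiMeasurePreserving_fst (μ := (volume : Measure ℝ))
            (ν := (volume : Measure ℝ))).ae (Measure.ae_ne volume p.1)
          simpa [Measure.volume_eq_prod] using this
        have e2 : ∀ᵐ z : ℝ × ℝ, z.2 ≠ p.2 := by
          have := (Measure.quasiMeasurePreserving_snd (μ := (volume : Measure ℝ))
            (ν := (volume : Measure ℝ))).ae (Measure.ae_ne volume p.2)
          simpa [Measure.volume_eq_prod] using this
        exact e1.and e2
      filter_upwards [ae_restrict_of_ae hn] with z hz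
      apply tendsto_nhds_of_eventually_eq
      have l1 : ∀ᶠ q : ℝ × ℝ in 𝓝 p, (z.1 ≤ q.1 ↔ z.1 ≤ p.1) := by
        rcases lt_or_gt_of_ne hz.1 with h | h
        · filter_upwards [continuous_fst.continuousAt.eventually (lt_mem_nhds h)] with q hq
          exact ⟨fun _ => h.le, fun _ => hq.le⟩
        · filter_upwards [continuous_fst.continuousAt.eventually (gt_mem_nhds h)] with q hq
          exact ⟨fun h' => absurd h' (not_le.2 hq), fun h' => absurd h' (not_le.2 h)⟩
      have l2 : ∀ᶠ q : ℝ × ℝ in 𝓝 p, (z.2 ≤ q.2 ↔ z.2 ≤ p.2) := by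
        rcases lt_or_gt_of_ne hz.2 with h | h
        · filter_upwards [continuous_snd.continuousAt.eventually (lt_mem_nhds h)] with q hq
          exact ⟨fun _ => h.le, fun _ => hq.le⟩
        · filter_upwards [continuous_snd.continuousAt.eventually (gt_mem_nhds h)] with q hq
          exact ⟨fun h' => absurd h' (not_le.2 hq), fun h' => absurd h' (not_le.2 h)⟩
      filter_upwards [l1, l2] with q h1 h2
      simp only [indicator, mem_prod, mem_Ioc, h1, h2]
  refine key.continuousOn.congr fun p hp => ?_
  beta_reduce
  rw [dbl hc hp.1 hp.2, setIntegral_indicator (measurableSet_Ioc.prod measurableSet_Ioc),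
    inter_eq_self_of_subset_right (subOmega hp.1 hp.2)]

theorem Rep2.continuousOn {T : ℝ} (hT : 0 ≤ T) {f : ℝ → ℝ → ℝ} {a b : ℝ → ℝ} {c : ℝ × ℝ → ℝ}
    (h : Rep2 T f a b c) : ContinuousOn (fun p : ℝ × ℝ => f p.1 p.2) (Omega T) := by
  have h1 : ContinuousOn (fun p : ℝ × ℝ => f p.1 0) (Omega T) :=
    (h.ra.continuousOn zero_le_one).comp continuous_fst.continuousOn fun p hp => hp.1
  have h2 : ContinuousOn (fun p : ℝ × ℝ => f 0 p.2) (Omega T) :=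
    (h.rb.continuousOn hT).comp continuous_snd.continuousOn fun p hp => hp.2
  refine (((h1.add h2).sub (continuousOn_const (c := f 0 0))).add
    (continuousOn_dbl (intOmega h.rc.1))).congr fun p hp => ?_
  have := h.rc.2 p.1 hp.1 p.2 hp.2
  simp only [Pi.add_apply, Pi.sub_apply]
  rw [← this]; ring

section

/-- The inner product of `Ŵ(Ω)`. -/
def innerHat (T : ℝ) (f g : ℝ → ℝ → ℝ) : ℝ :=
  (∫ t in (0 : ℝ)..T, deriv (f 0) t * deriv (g 0) t)
    + innerW21 1 (fun x => f x 0) (fun x => g x 0)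
    + ∫ x in (0 : ℝ)..1, ∫ t in (0 : ℝ)..T, dxt T f (x, t) * dxt T g (x, t)

theorem pos {T : ℝ} [h : Fact (0 < T)] : 0 < T := h.out

/-- The space `Ŵ(Ω)`. A function on `Ω` is represented by its extension by zero to `ℝ × ℝ`. -/
def WHatSub (T : ℝ) [Fact (0 < T)] : Submodule ℝ (ℝ → ℝ → ℝ) where
  carrier := {f | (∀ x t, (x, t) ∉ Omega T → f x t = 0) ∧ MemAC2 T f}
  add_mem' := fun {f g} hf hg =>
    ⟨fun x t h => by simp [hf.1 x t h, hg.1 x t h], hf.2.add pos.le hg.2⟩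
  zero_mem' := ⟨fun _ _ _ => rfl, by
    have hr : ∀ S : ℝ, Rep S (fun _ => 0) (fun _ => 0) := fun S => ⟨MemLp.zero, by simp⟩
    exact Rep2.memAC2 pos.le (a := fun _ => 0) (b := fun _ => 0) (c := fun _ => 0)
      ⟨hr 1, hr T, MemLp.zero, by simp⟩⟩
  smul_mem' := fun r f hf => ⟨fun x t h => by simp [hf.1 x t h], hf.2.smul pos.le r⟩

/-- The space `Ŵ(Ω)` as a type of its own; it carries the norm topology of `innerHat`. -/
def WHat (T : ℝ) [Fact (0 < T)] : Type := WHatSub T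

variable {T : ℝ} [Fact (0 < T)]

instance : AddCommGroup (WHat T) := inferInstanceAs (AddCommGroup (WHatSub T))
instance : Module ℝ (WHat T) := inferInstanceAs (Module ℝ (WHatSub T))
/-- The underlying function. -/
def WHat.fn (f : WHat T) : ℝ → ℝ → ℝ := f.1
instance : CoeFun (WHat T) (fun _ => ℝ → ℝ → ℝ) := ⟨WHat.fn⟩

/-- The inner product space structure pulled back along an injective linear map. -/
@[reducible]
def coreOf {V E : Type*} [AddCommGroup V] [Module ℝ V] [NormedAddCommGroup E]
    [InnerProductSpace ℝ E] (ip : V → V → ℝ) (F : V →ₗ[ℝ] E) (hF : ∀ v, F v = 0 → v = 0)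
    (h : ∀ u v, ip u v = inner ℝ (F u) (F v)) : InnerProductSpace.Core ℝ V where
  inner := ip
  conj_inner_symm u v := by simp [h, real_inner_comm]
  re_inner_nonneg u := by simp [h]
  add_left u v w := by simp [h, inner_add_left]
  smul_left u v r := by simp [h, inner_smul_left]
  definite u hu := hF u (by rwa [h, inner_self_eq_zero] at hu)

abbrev L2 (S : ℝ) : Type := Lp ℝ 2 (volume.restrict (Icc (0 : ℝ) S))
abbrev L2O (T : ℝ) : Type := Lp ℝ 2 ((volume : Measure (ℝ × ℝ)).restrict (Omega T))
abbrev E0 (T : ℝ) : Type := WithLp 2 (L2 1 × WithLp 2 (L2 T × L2O T))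

theorem WHat.rep (f : WHat T) :
    Rep2 T f (deriv fun x => f x 0) (deriv (f 0)) (dxt T f) := f.2.2.rep

theorem WHat.ext {f g : WHat T} (h : ∀ x ∈ Icc (0 : ℝ) 1, ∀ t ∈ Icc 0 T, f x t = g x t) : f = g := by
  apply Subtype.ext
  funext x t
  by_cases hx : (x, t) ∈ Omega T
  · exact h x hx.1 t hx.2
  · exact (f.2.1 x t hx).trans (g.2.1 x t hx).symm

theorem WHat.toLp_a {f : WHat T} {a b : ℝ → ℝ} {c : ℝ × ℝ → ℝ} (h : Rep2 T f a b c) :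
    f.rep.ra.1.toLp _ = h.ra.1.toLp _ :=
  MemLp.toLp_congr _ _ (h.ra.memW21 zero_le_one).2

theorem WHat.toLp_b {f : WHat T} {a b : ℝ → ℝ} {c : ℝ × ℝ → ℝ} (h : Rep2 T f a b c) :
    f.rep.rb.1.toLp _ = h.rb.1.toLp _ :=
  MemLp.toLp_congr _ _ (h.rb.memW21 pos.le).2

theorem WHat.toLp_c {f : WHat T} {a b : ℝ → ℝ} {c : ℝ × ℝ → ℝ} (h : Rep2 T f a b c) :
    f.rep.rc.1.toLp _ = h.rc.1.toLp _ :=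
  MemLp.toLp_congr _ _ (h.dxt pos.le)

/-- The triple of derivatives occurring in the inner product. -/
def jet0 : WHat T →ₗ[ℝ] E0 T where
  toFun f := WithLp.toLp 2 (f.rep.ra.1.toLp _, WithLp.toLp 2 (f.rep.rb.1.toLp _, f.rep.rc.1.toLp _))
  map_add' f g := by
    have h : Rep2 T (f + g : WHat T) _ _ _ := f.rep.add g.rep
    rw [WHat.toLp_a h, WHat.toLp_b h, WHat.toLp_c h]
    rfl
  map_smul' r f := by
    have h : Rep2 T (r • f : WHat T) _ _ _ := f.rep.smul r
    rw [WHat.toLp_a h, WHat.toLp_b h, WHat.toLp_c h]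
    rfl

theorem inner_toLp {α : Type*} [MeasurableSpace α] {μ : Measure α} {f g : α → ℝ}
    (hf : MemLp f 2 μ) (hg : MemLp g 2 μ) :
    inner ℝ (hf.toLp f) (hg.toLp g) = ∫ x, f x * g x ∂μ := by
  rw [L2.inner_def]
  refine integral_congr_ae ?_
  filter_upwards [hf.coeFn_toLp, hg.coeFn_toLp] with x h1 h2
  rw [h1, h2]; simp [mul_comm]

theorem inner_toLp_int {S : ℝ} (hS : 0 ≤ S) {f g : ℝ → ℝ}
    (hf : MemLp f 2 (volume.restrict (Icc 0 S))) (hg : MemLp g 2 (volume.restrict (Icc 0 S))) :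
    inner ℝ (hf.toLp f) (hg.toLp g) = ∫ x in (0 : ℝ)..S, f x * g x := by
  rw [inner_toLp, intervalIntegral.integral_of_le hS, integral_Icc_eq_integral_Ioc]

theorem inner_toLp_dbl {f g : ℝ × ℝ → ℝ}
    (hf : MemLp f 2 (volume.restrict (Omega T))) (hg : MemLp g 2 (volume.restrict (Omega T))) :
    inner ℝ (hf.toLp f) (hg.toLp g) =
      ∫ x in (0 : ℝ)..1, ∫ t in (0 : ℝ)..T, f (x, t) * g (x, t) := by
  rw [inner_toLp]
  exact (dbl_full (c := fun z => f z * g z) pos.le (hf.integrable_mul hg)).symm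

theorem inner_jet0 (f g : WHat T) : inner ℝ (jet0 f) (jet0 g) =
    (∫ x in (0 : ℝ)..1, deriv (fun x => f x 0) x * deriv (fun x => g x 0) x)
    + ((∫ t in (0 : ℝ)..T, deriv (f 0) t * deriv (g 0) t)
    + ∫ x in (0 : ℝ)..1, ∫ t in (0 : ℝ)..T, dxt T f (x, t) * dxt T g (x, t)) := by
  rw [← inner_toLp_int zero_le_one f.rep.ra.1 g.rep.ra.1,
    ← inner_toLp_int pos.le f.rep.rb.1 g.rep.rb.1, ← inner_toLp_dbl f.rep.rc.1 g.rep.rc.1]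
  simp only [jet0, LinearMap.coe_mk, AddHom.coe_mk, WithLp.prod_inner_apply]

/-- Auxiliary: point evaluation. -/
def WHat.eval (x t : ℝ) : WHat T →ₗ[ℝ] ℝ where
  toFun f := f x t
  map_add' _ _ := rfl
  map_smul' _ _ := rfl

abbrev EHat (T : ℝ) : Type := WithLp 2 (ℝ × E0 T)

/-- Auxiliary: the isometry of `Ŵ(Ω)` with `ℝ × L² × L² × L²`. -/
def jetHat : WHat T →ₗ[ℝ] EHat T :=
  (WithLp.linearEquiv 2 ℝ (ℝ × E0 T)).symm.toLinearMap ∘ₗ (WHat.eval 0 0).prod jet0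

theorem jetHat_apply (f : WHat T) : jetHat f = WithLp.toLp 2 (f 0 0, jet0 f) := rfl

theorem WHat.eq_of_jet {f : WHat T} {a b : ℝ → ℝ} {c : ℝ × ℝ → ℝ} (h : Rep2 T f a b c)
    {x t : ℝ} (hx : x ∈ Icc (0 : ℝ) 1) (ht : t ∈ Icc 0 T) :
    f x t = f 0 0 + (∫ y in (0 : ℝ)..x, a y) + (∫ s in (0 : ℝ)..t, b s)
      + ∫ z in Ioc 0 x ×ˢ Ioc 0 t, c z := by
  have h1 := h.ra.2 x hx
  have h2 := h.rb.2 t ht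
  have h3 := h.rc.2 x hx t ht
  rw [dbl (intOmega h.rc.1) hx ht] at h3
  linarith

theorem jet0_zero {f : WHat T} (h : jet0 f = 0) {x t : ℝ} (hx : x ∈ Icc (0 : ℝ) 1)
    (ht : t ∈ Icc 0 T) : f x t = f 0 0 := by
  have h1 : f.rep.ra.1.toLp _ = 0 := congrArg (fun e : E0 T => e.ofLp.1) h
  have h2 : f.rep.rb.1.toLp _ = 0 := congrArg (fun e : E0 T => e.ofLp.2.ofLp.1) h
  have h3 : f.rep.rc.1.toLp _ = 0 := congrArg (fun e : E0 T => e.ofLp.2.ofLp.2) h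
  rw [← MemLp.toLp_zero MemLp.zero', MemLp.toLp_eq_toLp_iff] at h1 h2 h3
  rw [WHat.eq_of_jet f.rep hx ht, intervalIntegral.integral_of_le hx.1,
    intervalIntegral.integral_of_le ht.1]
  rw [integral_eq_zero_of_ae (ae_restrict_of_ae_restrict_of_subset
      (Ioc_subset_Icc_self.trans (Icc_subset_Icc_right hx.2)) h1),
    integral_eq_zero_of_ae (ae_restrict_of_ae_restrict_of_subset
      (Ioc_subset_Icc_self.trans (Icc_subset_Icc_right ht.2)) h2),
    integral_eq_zero_of_ae (ae_restrict_of_ae_restrict_of_subset (subOmega hx ht) h3)]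
  ring

theorem jetHat_inj (f : WHat T) (h : jetHat f = 0) : f = 0 := by
  have h0 : f 0 0 = 0 := congrArg (fun e : EHat T => e.ofLp.1) h
  have h1 : jet0 f = 0 := congrArg (fun e : EHat T => e.ofLp.2) h
  exact WHat.ext fun x hx t ht => (jet0_zero h1 hx ht).trans h0

theorem innerHat_eq (f g : WHat T) : innerHat T f g = inner ℝ (jetHat f) (jetHat g) := by
  rw [jetHat_apply, jetHat_apply, WithLp.prod_inner_apply]
  simp only [inner_jet0, innerHat, innerW21]
  simp
  ring

@[reducible] def coreHat : InnerProductSpace.Core ℝ (WHat T) :=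
  coreOf (fun f g => innerHat T f g) jetHat jetHat_inj innerHat_eq

instance : NormedAddCommGroup (WHat T) := (coreHat (T := T)).toNormedAddCommGroup
instance : InnerProductSpace ℝ (WHat T) := InnerProductSpace.ofCore (coreHat (T := T)).toCore

theorem WHat.inner_eq (f g : WHat T) : inner ℝ f g = innerHat T f g := rfl

theorem norm_jetHat (f : WHat T) : ‖jetHat f‖ = ‖f‖ := by
  rw [@norm_eq_sqrt_real_inner _ _ _ f, @norm_eq_sqrt_real_inner _ _ _ (jetHat f),
    WHat.inner_eq, innerHat_eq]

open Classical in
/-- The element of `Ŵ(Ω)` given by a function on `Ω`. -/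
def WHat.mk' (f : ℝ → ℝ → ℝ) (hf : MemAC2 T f) : WHat T :=
  ⟨fun x t => if (x, t) ∈ Omega T then f x t else 0, fun x t h => by simp [h],
    hf.congr pos.le fun x hx t ht => if_pos (show (x, t) ∈ Omega T from ⟨hx, ht⟩)⟩

theorem WHat.mk'_apply {f : ℝ → ℝ → ℝ} {hf : MemAC2 T f} {x t : ℝ} (hx : x ∈ Icc (0 : ℝ) 1)
    (ht : t ∈ Icc 0 T) : WHat.mk' f hf x t = f x t :=
  if_pos (show (x, t) ∈ Omega T from ⟨hx, ht⟩)

theorem jetHat_surj (e : EHat T) : ∃ f : WHat T, jetHat f = e := by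
  obtain ⟨r, ⟨a, ⟨b, c⟩⟩⟩ := e
  set F : ℝ → ℝ → ℝ := fun x t => r + (∫ y in (0 : ℝ)..x, a y) + (∫ s in (0 : ℝ)..t, b s)
      + ∫ y in (0 : ℝ)..x, ∫ s in (0 : ℝ)..t, c (y, s) with hF
  have hR : Rep2 T F a b c :=
    ⟨⟨Lp.memLp a, fun x hx => by simp [hF]⟩, ⟨Lp.memLp b, fun t ht => by simp [hF]⟩,
      ⟨Lp.memLp c, fun x hx t ht => by simp [hF]; ring⟩⟩
  refine ⟨WHat.mk' F (hR.memAC2 pos.le), ?_⟩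
  have hR' : Rep2 T (WHat.mk' F (hR.memAC2 pos.le)) a b c :=
    hR.congr pos.le fun x hx t ht => WHat.mk'_apply hx ht
  have h0 : WHat.mk' F (hR.memAC2 pos.le) 0 0 = r := by
    rw [WHat.mk'_apply (by simp) ⟨le_rfl, pos.le⟩]; simp [hF]
  rw [jetHat_apply, h0]
  simp only [jet0, LinearMap.coe_mk, AddHom.coe_mk]
  rw [WHat.toLp_a hR', WHat.toLp_b hR', WHat.toLp_c hR']
  simp

instance : CompleteSpace (WHat T) := by
  let e : WHat T ≃ₗᵢ[ℝ] EHat T :=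
    LinearIsometryEquiv.ofSurjective ⟨jetHat, norm_jetHat⟩ jetHat_surj
  exact (completeSpace_congr (e := e.toEquiv) e.isometry.isUniformEmbedding).2 inferInstance

theorem abs_setIntegral_le {α : Type*} [MeasurableSpace α] {μ : Measure α} [IsFiniteMeasure μ]
    {g : α → ℝ} (hg : MemLp g 2 μ) {s : Set α} (hs : MeasurableSet s) :
    |∫ x in s, g x ∂μ| ≤ (μ.real univ) ^ (1 / 2 : ℝ) * ‖hg.toLp g‖ := by
  have h1 := L2.inner_indicatorConstLp_one (𝕜 := ℝ) hs (measure_ne_top μ s) (hg.toLp g)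
  have h2 : ∫ x in s, g x ∂μ = ∫ x in s, hg.toLp g x ∂μ :=
    integral_congr_ae (ae_restrict_of_ae (hg.coeFn_toLp.symm))
  rw [h2, ← h1]
  refine (abs_real_inner_le_norm _ _).trans (mul_le_mul_of_nonneg_right ?_ (norm_nonneg _))
  rw [norm_indicatorConstLp (by norm_num) (by norm_num)]
  simp only [norm_one, one_mul, ENNReal.toReal_ofNat]
  exact Real.rpow_le_rpow measureReal_nonneg (measureReal_mono (subset_univ s)) (by norm_num)

theorem norm_fst_le {E F : Type*} [NormedAddCommGroup E] [NormedAddCommGroup F]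
    (x : WithLp 2 (E × F)) : ‖x.ofLp.1‖ ≤ ‖x‖ := by
  rw [WithLp.prod_norm_eq_of_L2]
  exact Real.le_sqrt_of_sq_le (le_add_of_nonneg_right (sq_nonneg _))

theorem norm_snd_le {E F : Type*} [NormedAddCommGroup E] [NormedAddCommGroup F]
    (x : WithLp 2 (E × F)) : ‖x.ofLp.2‖ ≤ ‖x‖ := by
  rw [WithLp.prod_norm_eq_of_L2]
  exact Real.le_sqrt_of_sq_le (le_add_of_nonneg_left (sq_nonneg _))

theorem abs_int_le {S : ℝ} {g : ℝ → ℝ} (hg : MemLp g 2 (volume.restrict (Icc 0 S))) {t : ℝ}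
    (ht : t ∈ Icc 0 S) : |∫ s in (0 : ℝ)..t, g s| ≤
      ((volume.restrict (Icc 0 S)).real univ) ^ (1 / 2 : ℝ) * ‖hg.toLp g‖ := by
  have := abs_setIntegral_le hg (measurableSet_Ioc (a := (0 : ℝ)) (b := t))
  rwa [Measure.restrict_restrict_of_subset
    (Ioc_subset_Icc_self.trans (Icc_subset_Icc_right ht.2)),
    ← intervalIntegral.integral_of_le ht.1] at this

/-- A pointwise bound. -/
theorem WHat.bound : ∃ C : ℝ, 0 ≤ C ∧ ∀ f : WHat T, ∀ x ∈ Icc (0 : ℝ) 1, ∀ t ∈ Icc 0 T,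
    |f x t| ≤ C * ‖f‖ := by
  refine ⟨1 + ((volume.restrict (Icc (0 : ℝ) 1)).real univ) ^ (1 / 2 : ℝ)
    + ((volume.restrict (Icc (0 : ℝ) T)).real univ) ^ (1 / 2 : ℝ)
    + ((volume.restrict (Omega T)).real univ) ^ (1 / 2 : ℝ), by positivity,
    fun f x hx t ht => ?_⟩
  have h0 : ‖jet0 f‖ ≤ ‖f‖ := by rw [← norm_jetHat]; exact norm_snd_le (jetHat f)
  have hr : |f 0 0| ≤ ‖f‖ := by rw [← norm_jetHat]; exact norm_fst_le (jetHat f)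
  have ha : ‖f.rep.ra.1.toLp _‖ ≤ ‖f‖ := (norm_fst_le (jet0 f)).trans h0
  have h1 : ‖(jet0 f).ofLp.2‖ ≤ ‖f‖ := (norm_snd_le (jet0 f)).trans h0
  have hb : ‖f.rep.rb.1.toLp _‖ ≤ ‖f‖ := (norm_fst_le (jet0 f).ofLp.2).trans h1
  have hc : ‖f.rep.rc.1.toLp _‖ ≤ ‖f‖ := (norm_snd_le (jet0 f).ofLp.2).trans h1
  have ka := (abs_int_le f.rep.ra.1 hx).trans (mul_le_mul_of_nonneg_left ha (by positivity))
  have kb := (abs_int_le f.rep.rb.1 ht).trans (mul_le_mul_of_nonneg_left hb (by positivity))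
  have kc := (abs_setIntegral_le f.rep.rc.1
    ((measurableSet_Ioc (a := (0 : ℝ)) (b := x)).prod (measurableSet_Ioc (a := (0 : ℝ)) (b := t)))).trans
    (mul_le_mul_of_nonneg_left hc (by positivity))
  rw [Measure.restrict_restrict_of_subset (subOmega hx ht)] at kc
  rw [WHat.eq_of_jet f.rep hx ht]
  refine (abs_add_le _ _).trans ?_
  refine (add_le_add ((abs_add_le _ _).trans (add_le_add ((abs_add_le _ _).trans
    (add_le_add hr ka)) kb)) kc).trans (le_of_eq ?_)
  ring

end

abbrev res (S : ℝ) : Measure ℝ := volume.restrict (Icc (0 : ℝ) S)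

theorem slice_bound {A B : ℝ} {c : ℝ × ℝ → ℝ}
    (hc : MemLp c 2 ((res A).prod (res B))) :
    ∃ k : ℝ → ℝ, Integrable k (res A) ∧ ∀ᵐ y ∂(res A), ∀ s ∈ Icc 0 B,
      (∫ r in (0 : ℝ)..s, c (y, r)) ^ 2 ≤ k y := by
  have hsq : Integrable (fun z => c z ^ 2) ((res A).prod (res B)) := hc.integrable_sq
  refine ⟨fun y => ((res B).real univ ^ (1 / 2 : ℝ)) ^ 2 * ∫ r, c (y, r) ^ 2 ∂(res B),
    hsq.integral_prod_left.const_mul _, ?_⟩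
  filter_upwards [hsq.prod_right_ae, hc.1.prodMk_left] with y h1 h2 s hs
  have hm : MemLp (fun r => c (y, r)) 2 (res B) := (memLp_two_iff_integrable_sq h2).2 h1
  have h3 := abs_int_le hm hs
  have h4 : ‖hm.toLp _‖ ^ 2 = ∫ r, c (y, r) ^ 2 ∂(res B) := by
    rw [← real_inner_self_eq_norm_sq, inner_toLp]
    simp only [sq]
  rw [← h4, ← mul_pow, ← sq_abs]
  exact pow_le_pow_left₀ (abs_nonneg _) h3 2

theorem ae_prod_fst {A B : ℝ} {P : ℝ → Prop} (h : ∀ᵐ y ∂(res A), P y) :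
    ∀ᵐ z ∂((res A).prod (res B)), P z.1 ∧ z.2 ∈ Icc 0 B := by
  have h1 := (Measure.quasiMeasurePreserving_fst (μ := res A) (ν := res B)).ae h
  have h2 := (Measure.quasiMeasurePreserving_snd (μ := res A) (ν := res B)).ae
    (ae_restrict_mem measurableSet_Icc)
  exact h1.and h2

theorem memLp_prim {A B : ℝ} {c : ℝ × ℝ → ℝ} (hm : StronglyMeasurable c)
    (hc : MemLp c 2 ((res A).prod (res B))) :
    MemLp (fun z : ℝ × ℝ => ∫ r in (0 : ℝ)..z.2, c (z.1, r)) 2 ((res A).prod (res B)) := by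
  obtain ⟨k, hk, hb⟩ := slice_bound hc
  have hmeas : AEStronglyMeasurable (fun z : ℝ × ℝ => ∫ r in (0 : ℝ)..z.2, c (z.1, r))
      ((res A).prod (res B)) := by
    have h1 : StronglyMeasurable (fun q : (ℝ × ℝ) × ℝ =>
        {q : (ℝ × ℝ) × ℝ | 0 < q.2 ∧ q.2 ≤ q.1.2}.indicator (fun q => c (q.1.1, q.2)) q) := by
      refine (hm.comp_measurable (by fun_prop)).indicator ?_
      exact (measurableSet_lt measurable_const measurable_snd).inter
        (measurableSet_le measurable_snd (measurable_snd.comp measurable_fst))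
    have h2 := (h1.integral_prod_right' (ν := volume)).aestronglyMeasurable
      (μ := (res A).prod (res B))
    refine h2.congr ?_
    filter_upwards [ae_prod_fst (A := A) (B := B) (P := fun _ => True) (by simp)] with z hz
    rw [intervalIntegral.integral_of_le hz.2.1, ← integral_indicator measurableSet_Ioc]
    rfl
  rw [memLp_two_iff_integrable_sq hmeas]
  refine (hk.comp_fst (res B)).mono' (hmeas.pow 2) ?_
  filter_upwards [ae_prod_fst (B := B) hb] with z hz
  rw [Real.norm_of_nonneg (sq_nonneg _)]
  exact hz.1 z.2 hz.2

theorem memLp_trace {A B : ℝ} (hB : 0 ≤ B) {c : ℝ × ℝ → ℝ}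
    (hc : MemLp c 2 ((res A).prod (res B))) :
    MemLp (fun y => ∫ r in (0 : ℝ)..B, c (y, r)) 2 (res A) := by
  obtain ⟨k, hk, hb⟩ := slice_bound hc
  have hmeas : AEStronglyMeasurable (fun y => ∫ r in (0 : ℝ)..B, c (y, r)) (res A) := by
    refine hc.1.integral_prod_right'.congr (Eventually.of_forall fun y => ?_)
    beta_reduce
    rw [intervalIntegral.integral_of_le hB, ← integral_Icc_eq_integral_Ioc]
  rw [memLp_two_iff_integrable_sq hmeas]
  refine hk.mono' (hmeas.pow 2) ?_
  filter_upwards [hb] with z hz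
  rw [Real.norm_of_nonneg (sq_nonneg _)]
  exact hz B ⟨hB, le_rfl⟩

theorem memLp_swap {A B : ℝ} {c : ℝ × ℝ → ℝ} (hc : MemLp c 2 ((res A).prod (res B))) :
    MemLp (fun z : ℝ × ℝ => c z.swap) 2 ((res B).prod (res A)) :=
  hc.comp_measurePreserving Measure.measurePreserving_swap

theorem swap_int {T : ℝ} {c : ℝ × ℝ → ℝ} (hc : IntegrableOn c (Omega T)) {x t : ℝ}
    (hx : x ∈ Icc (0 : ℝ) 1) (ht : t ∈ Icc 0 T) :
    ∫ y in (0 : ℝ)..x, ∫ s in (0 : ℝ)..t, c (y, s) =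
      ∫ s in (0 : ℝ)..t, ∫ y in (0 : ℝ)..x, c (y, s) := by
  simp only [intervalIntegral.integral_of_le hx.1, intervalIntegral.integral_of_le ht.1]
  refine integral_integral_swap (f := fun y s => c (y, s)) ?_
  rw [Measure.prod_restrict, ← Measure.volume_eq_prod]
  exact hc.mono_set (subOmega hx ht)

theorem intInt_left {T : ℝ} {c : ℝ × ℝ → ℝ} (hc : IntegrableOn c (Omega T)) {x t : ℝ}
    (hx : x ∈ Icc (0 : ℝ) 1) (ht : t ∈ Icc 0 T) :
    IntervalIntegrable (fun y => ∫ s in (0 : ℝ)..t, c (y, s)) volume 0 x := by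
  rw [intervalIntegrable_iff_integrableOn_Ioc_of_le hx.1]
  have h : Integrable c ((volume.restrict (Ioc 0 x)).prod (volume.restrict (Ioc 0 t))) := by
    rw [Measure.prod_restrict, ← Measure.volume_eq_prod]
    exact hc.mono_set (subOmega hx ht)
  simp only [intervalIntegral.integral_of_le ht.1]
  exact h.integral_prod_left

theorem intInt_right {T : ℝ} {c : ℝ × ℝ → ℝ} (hc : IntegrableOn c (Omega T)) {x t : ℝ}
    (hx : x ∈ Icc (0 : ℝ) 1) (ht : t ∈ Icc 0 T) :
    IntervalIntegrable (fun s => ∫ y in (0 : ℝ)..x, c (y, s)) volume 0 t := by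
  rw [intervalIntegrable_iff_integrableOn_Ioc_of_le ht.1]
  have h : Integrable c ((volume.restrict (Ioc 0 x)).prod (volume.restrict (Ioc 0 t))) := by
    rw [Measure.prod_restrict, ← Measure.volume_eq_prod]
    exact hc.mono_set (subOmega hx ht)
  simp only [intervalIntegral.integral_of_le hx.1]
  exact h.integral_prod_right

theorem Rep2.exists_meas {T : ℝ} {f : ℝ → ℝ → ℝ} {a b : ℝ → ℝ} {c : ℝ × ℝ → ℝ}
    (h : Rep2 T f a b c) : ∃ c', StronglyMeasurable c' ∧ Rep2 T f a b c' := by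
  refine ⟨h.rc.1.1.mk c, h.rc.1.1.stronglyMeasurable_mk, h.ra, h.rb, ?_⟩
  have h1 : MemLp (h.rc.1.1.mk c) 2 (volume.restrict (Omega T)) := h.rc.1.ae_eq h.rc.1.1.ae_eq_mk
  refine ⟨h1, fun x hx t ht => ?_⟩
  rw [h.rc.2 x hx t ht, dbl (intOmega h1) hx ht, dbl (intOmega h.rc.1) hx ht]
  exact integral_congr_ae
    (ae_restrict_of_ae_restrict_of_subset (subOmega hx ht) h.rc.1.1.ae_eq_mk)

theorem memLp_cont {S : ℝ} {f : ℝ → ℝ} (hf : ContinuousOn f (Icc 0 S)) : MemLp f 2 (res S) := by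
  have hm : AEStronglyMeasurable f (res S) := hf.aestronglyMeasurable measurableSet_Icc
  rw [memLp_two_iff_integrable_sq hm]
  exact (hf.pow 2).integrableOn_compact isCompact_Icc

theorem Rep2.slice_x {T : ℝ} (hT : 0 ≤ T) {f : ℝ → ℝ → ℝ} {a b : ℝ → ℝ} {c : ℝ × ℝ → ℝ}
    (h : Rep2 T f a b c) {x : ℝ} (hx : x ∈ Icc (0 : ℝ) 1) : ContinuousOn (f x) (Icc 0 T) :=
  (h.continuousOn hT).comp (f := fun t => (x, t)) (by fun_prop) fun _ ht => ⟨hx, ht⟩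

theorem Rep2.slice_t {T : ℝ} (hT : 0 ≤ T) {f : ℝ → ℝ → ℝ} {a b : ℝ → ℝ} {c : ℝ × ℝ → ℝ}
    (h : Rep2 T f a b c) {t : ℝ} (ht : t ∈ Icc 0 T) : ContinuousOn (fun x => f x t) (Icc 0 1) :=
  (h.continuousOn hT).comp (f := fun x => (x, t)) (by fun_prop) fun _ hx => ⟨hx, ht⟩

theorem memAC2_Vt {T : ℝ} (hT : 0 ≤ T) {f : ℝ → ℝ → ℝ} (hf : MemAC2 T f) :
    MemAC2 T (fun x t => ∫ s in (0 : ℝ)..t, f x s) := by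
  obtain ⟨c, hcm, h⟩ := hf.rep.exists_meas
  set a := deriv fun x => f x 0
  have hc := h.rc.1
  have hmem : MemLp (fun z : ℝ × ℝ => a z.1 + ∫ r in (0 : ℝ)..z.2, c (z.1, r)) 2
      (volume.restrict (Omega T)) := by
    rw [restrict_Omega] at hc ⊢
    exact (h.ra.1.comp_fst _).add (memLp_prim hcm hc)
  refine Rep2.memAC2 hT (a := fun _ => 0) (b := f 0)
    ⟨⟨MemLp.zero, by simp⟩, ⟨memLp_cont (h.slice_x hT (by simp)), by simp⟩, hmem,
      fun x hx t ht => ?_⟩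
  rw [swap_int (intOmega hmem) hx ht]
  simp only [intervalIntegral.integral_same, sub_zero, add_zero]
  have hi : ∀ {x}, x ∈ Icc (0 : ℝ) 1 → IntervalIntegrable (f x) volume 0 t := fun hx =>
    intInt (memLp_cont (h.slice_x hT hx)) ht
  rw [← intervalIntegral.integral_sub (hi hx) (hi (by simp))]
  refine intervalIntegral.integral_congr fun s hs => ?_
  rw [uIcc_of_le ht.1] at hs
  have hs' : s ∈ Icc 0 T := ⟨hs.1, hs.2.trans ht.2⟩
  rw [intervalIntegral.integral_add (intInt h.ra.1 hx) (intInt_left (intOmega hc) hx hs'),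
    ← h.rc.2 x hx s hs']
  have := h.ra.2 x hx
  linarith

theorem memAC2_Vx {T : ℝ} (hT : 0 ≤ T) {f : ℝ → ℝ → ℝ} (hf : MemAC2 T f) :
    MemAC2 T (fun x t => ∫ y in (0 : ℝ)..x, f y t) := by
  obtain ⟨c, hcm, h⟩ := hf.rep.exists_meas
  set b := deriv (f 0)
  have hc := h.rc.1
  have hmem : MemLp (fun z : ℝ × ℝ => b z.2 + ∫ r in (0 : ℝ)..z.1, c (r, z.2)) 2
      (volume.restrict (Omega T)) := by
    rw [restrict_Omega] at hc ⊢
    have h1 := memLp_swap (memLp_prim (hcm.comp_measurable measurable_swap) (memLp_swap hc))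
    exact (h.rb.1.comp_snd _).add h1
  have h0 : (0 : ℝ) ∈ Icc 0 T := ⟨le_rfl, hT⟩
  refine Rep2.memAC2 hT (a := fun x => f x 0) (b := fun _ => 0)
    ⟨⟨memLp_cont (h.slice_t hT h0), by simp⟩, ⟨MemLp.zero, by simp⟩, hmem,
      fun x hx t ht => ?_⟩
  simp only [intervalIntegral.integral_same, sub_zero, add_zero]
  have hi : ∀ {t}, t ∈ Icc 0 T → IntervalIntegrable (fun x => f x t) volume 0 x := fun ht =>
    intInt (memLp_cont (h.slice_t hT ht)) hx
  rw [← intervalIntegral.integral_sub (hi ht) (hi h0)]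
  refine intervalIntegral.integral_congr fun y hy => ?_
  rw [uIcc_of_le hx.1] at hy
  have hy' : y ∈ Icc (0 : ℝ) 1 := ⟨hy.1, hy.2.trans hx.2⟩
  rw [intervalIntegral.integral_add (intInt h.rb.1 ht) (intInt_right (intOmega hc) hy' ht),
    ← swap_int (intOmega hc) hy' ht, ← h.rc.2 y hy' t ht]
  have := h.rb.2 t ht
  linarith

theorem rep_trace {T : ℝ} {f : ℝ → ℝ → ℝ} (hf : MemAC2 T f) :
    ∃ q, Rep T (f 1) q := by
  obtain ⟨c, hcm, h⟩ := hf.rep.exists_meas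
  have hc := h.rc.1
  rw [restrict_Omega] at hc
  refine ⟨fun s => deriv (f 0) s + ∫ y in (0 : ℝ)..1, c (y, s),
    h.rb.1.add (memLp_trace zero_le_one (memLp_swap hc)), fun t ht => ?_⟩
  have h1 : (1 : ℝ) ∈ Icc (0 : ℝ) 1 := by simp
  rw [intervalIntegral.integral_add (intInt h.rb.1 ht) (intInt_right (intOmega h.rc.1) h1 ht),
    ← swap_int (intOmega h.rc.1) h1 ht, ← h.rc.2 1 h1 t ht]
  have := h.rb.2 t ht
  linarith

theorem memAC2_xp {T : ℝ} (hT : 0 ≤ T) {p q : ℝ → ℝ} (hp : Rep T p q) :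
    MemAC2 T (fun x t => x * p t) := by
  have hq : MemLp (fun z : ℝ × ℝ => q z.2) 2 (volume.restrict (Omega T)) := by
    rw [restrict_Omega]; exact hp.1.comp_snd _
  refine Rep2.memAC2 hT (a := fun _ => p 0) (b := fun _ => 0)
    ⟨⟨memLp_cont continuousOn_const, by simp⟩, ⟨MemLp.zero, by simp⟩, hq, fun x hx t ht => ?_⟩
  simp only [intervalIntegral.integral_const, smul_eq_mul, hp.2 t ht]
  ring

section

/-- The partial derivative `∂/∂x` on `Ω` (one-sided at `x = 0` and `x = 1`). -/
def dx (u : ℝ → ℝ → ℝ) : ℝ → ℝ → ℝ := fun x t => derivWithin (fun y => u y t) (Icc 0 1) x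

/-- The partial derivative `∂/∂t` on `Ω` (one-sided at `t = 0` and `t = T`). -/
def dt (T : ℝ) (u : ℝ → ℝ → ℝ) : ℝ → ℝ → ℝ := fun x t => derivWithin (u x) (Icc 0 T) t

/-- The functions `U i j`, `i, j ≤ 2`, are the partial derivatives `∂^{i+j}u/∂x^i∂t^j` on `Ω`, which
exist in every order of differentiation. -/
structure IsJet (T : ℝ) (u : ℝ → ℝ → ℝ) (U : ℕ → ℕ → ℝ → ℝ → ℝ) : Prop where
  zero : ∀ x ∈ Icc (0 : ℝ) 1, ∀ t ∈ Icc 0 T, U 0 0 x t = u x t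
  hasDeriv_x : ∀ i < 2, ∀ j ≤ 2, ∀ x ∈ Icc (0 : ℝ) 1, ∀ t ∈ Icc 0 T,
    HasDerivWithinAt (fun y => U i j y t) (U (i + 1) j x t) (Icc 0 1) x
  hasDeriv_t : ∀ i ≤ 2, ∀ j < 2, ∀ x ∈ Icc (0 : ℝ) 1, ∀ t ∈ Icc 0 T,
    HasDerivWithinAt (U i j x) (U i (j + 1) x t) (Icc 0 T) t

/-- Membership in `W(Ω)`: the derivative `∂⁴u/∂x²∂t²` exists, is completely continuous on `Ω` with
square integrable densities (in particular `∂⁶u/∂x³∂t³ ∈ L²(Ω)`), and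
`u(x,0) = ∂u/∂t(x,0) = u(0,t) = u(1,t) = 0`. As above, `u` is extended by zero outside `Ω`. -/
def MemW (T : ℝ) (u : ℝ → ℝ → ℝ) : Prop :=
  (∀ x t, (x, t) ∉ Omega T → u x t = 0) ∧ (∃ U, IsJet T u U) ∧
    MemAC2 T (dx^[2] ((dt T)^[2] u)) ∧
    (∀ x ∈ Icc (0 : ℝ) 1, u x 0 = 0) ∧ (∀ x ∈ Icc (0 : ℝ) 1, dt T u x 0 = 0) ∧
    (∀ t ∈ Icc 0 T, u 0 t = 0) ∧ (∀ t ∈ Icc 0 T, u 1 t = 0)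

/-- The inner product of `W_2^3[0,1]`:
`f(0)g(0) + f'(0)g'(0) + f'(1)g'(1) + ∫₀¹ f'''g'''`. -/
def innerW23 (f g : ℝ → ℝ) : ℝ :=
  let d : (ℝ → ℝ) → ℝ → ℝ := fun h => derivWithin h (Icc 0 1)
  f 0 * g 0 + d f 0 * d g 0 + d f 1 * d g 1 +
    ∫ x in (0 : ℝ)..1, deriv (d (d f)) x * deriv (d (d g)) x

/-- The inner product of `W(Ω)`. Here `∂³/∂t³ ∂^i/∂x^i u(0,·)` is the almost everywhere derivative of
`∂²/∂t² ∂^i/∂x^i u(0,·)`, and `∂⁶u/∂x³∂t³` is the mixed derivative of `∂⁴u/∂x²∂t²`. -/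
def innerW (T : ℝ) (u g : ℝ → ℝ → ℝ) : ℝ :=
  (∑ i ∈ Finset.range 3, ∫ t in (0 : ℝ)..T,
      deriv ((dt T)^[2] (dx^[i] u) 0) t * deriv ((dt T)^[2] (dx^[i] g) 0) t)
    + (∑ j ∈ Finset.range 3,
      innerW23 (fun x => (dt T)^[j] u x 0) (fun x => (dt T)^[j] g x 0))
    + ∫ x in (0 : ℝ)..1, ∫ t in (0 : ℝ)..T,
      dxt T (dx^[2] ((dt T)^[2] u)) (x, t) * dxt T (dx^[2] ((dt T)^[2] g)) (x, t)

/-- Auxiliary: `∂^{i+j}u/∂x^i∂t^j`. -/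
def pd (T : ℝ) (u : ℝ → ℝ → ℝ) (i j : ℕ) : ℝ → ℝ → ℝ := dx^[i] ((dt T)^[j] u)

variable {T : ℝ}

theorem zmem1 : (0 : ℝ) ∈ Icc (0 : ℝ) 1 := by simp
theorem omem1 : (1 : ℝ) ∈ Icc (0 : ℝ) 1 := by simp

theorem IsJet.pd_eq (hT : 0 < T) {u : ℝ → ℝ → ℝ} {U : ℕ → ℕ → ℝ → ℝ → ℝ} (h : IsJet T u U)
    {i j : ℕ} (hi : i ≤ 2) (hj : j ≤ 2) : ∀ x ∈ Icc (0 : ℝ) 1, ∀ t ∈ Icc 0 T,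
      pd T u i j x t = U i j x t := by
  induction i with
  | zero =>
    induction j with
    | zero => intro x hx t ht; exact (h.zero x hx t ht).symm
    | succ j ih =>
      intro x hx t ht
      have ih := ih (by omega)
      simp only [pd, Function.iterate_zero, id, Function.iterate_succ_apply'] at ih ⊢
      have h1 := (h.hasDeriv_t 0 (by omega) j (by omega) x hx t ht).congr
        (fun s hs => ih x hx s hs) (ih x hx t ht)
      exact h1.derivWithin (uniqueDiffOn_Icc hT t ht)
  | succ i ih =>
    intro x hx t ht
    have ih := ih (by omega)
    simp only [pd, Function.iterate_succ_apply'] at ih ⊢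
    have h1 := (h.hasDeriv_x i (by omega) j hj x hx t ht).congr
      (fun s hs => ih s hs t ht) (ih x hx t ht)
    exact h1.derivWithin (uniqueDiffOn_Icc one_pos x hx)

theorem IsJet.pd_eq' (hT : 0 < T) {u : ℝ → ℝ → ℝ} {U : ℕ → ℕ → ℝ → ℝ → ℝ} (h : IsJet T u U)
    {i j : ℕ} (hi : i ≤ 2) (hj : j ≤ 2) : ∀ x ∈ Icc (0 : ℝ) 1, ∀ t ∈ Icc 0 T,
      (dt T)^[j] (dx^[i] u) x t = U i j x t := by
  induction j with
  | zero =>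
    induction i with
    | zero => intro x hx t ht; exact (h.zero x hx t ht).symm
    | succ i ih =>
      intro x hx t ht
      have ih := ih (by omega)
      simp only [Function.iterate_zero, id, Function.iterate_succ_apply'] at ih ⊢
      have h1 := (h.hasDeriv_x i (by omega) 0 (by omega) x hx t ht).congr
        (fun s hs => ih s hs t ht) (ih x hx t ht)
      exact h1.derivWithin (uniqueDiffOn_Icc one_pos x hx)
  | succ j ih =>
    intro x hx t ht
    have ih := ih (by omega)
    simp only [Function.iterate_succ_apply'] at ih ⊢
    have h1 := (h.hasDeriv_t i hi j (by omega) x hx t ht).congr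
      (fun s hs => ih x hx s hs) (ih x hx t ht)
    exact h1.derivWithin (uniqueDiffOn_Icc hT t ht)

theorem IsJet.canon (hT : 0 < T) {u : ℝ → ℝ → ℝ} {U : ℕ → ℕ → ℝ → ℝ → ℝ} (h : IsJet T u U) :
    IsJet T u (pd T u) := by
  refine ⟨fun x _ t _ => rfl, fun i hi j hj x hx t ht => ?_, fun i hi j hj x hx t ht => ?_⟩
  · rw [h.pd_eq hT (i := i + 1) (by omega) hj x hx t ht]
    exact (h.hasDeriv_x i hi j hj x hx t ht).congr
      (fun s hs => h.pd_eq hT hi.le hj s hs t ht) (h.pd_eq hT hi.le hj x hx t ht)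
  · rw [h.pd_eq hT (j := j + 1) hi (by omega) x hx t ht]
    exact (h.hasDeriv_t i hi j hj x hx t ht).congr
      (fun s hs => h.pd_eq hT hi hj.le x hx s hs) (h.pd_eq hT hi hj.le x hx t ht)

theorem IsJet.add {u v : ℝ → ℝ → ℝ} {U V : ℕ → ℕ → ℝ → ℝ → ℝ} (h : IsJet T u U)
    (h' : IsJet T v V) : IsJet T (u + v) (fun i j x t => U i j x t + V i j x t) :=
  ⟨fun x hx t ht => by simp [h.zero x hx t ht, h'.zero x hx t ht],
    fun i hi j hj x hx t ht => (h.hasDeriv_x i hi j hj x hx t ht).add (h'.hasDeriv_x i hi j hj x hx t ht),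
    fun i hi j hj x hx t ht => (h.hasDeriv_t i hi j hj x hx t ht).add (h'.hasDeriv_t i hi j hj x hx t ht)⟩

theorem IsJet.smul {u : ℝ → ℝ → ℝ} {U : ℕ → ℕ → ℝ → ℝ → ℝ} (r : ℝ) (h : IsJet T u U) :
    IsJet T (r • u) (fun i j x t => r * U i j x t) :=
  ⟨fun x hx t ht => by simp [h.zero x hx t ht],
    fun i hi j hj x hx t ht => (h.hasDeriv_x i hi j hj x hx t ht).const_mul r,
    fun i hi j hj x hx t ht => (h.hasDeriv_t i hi j hj x hx t ht).const_mul r⟩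

theorem MemW.jet (hT : 0 < T) {u : ℝ → ℝ → ℝ} (h : MemW T u) : IsJet T u (pd T u) := by
  obtain ⟨U, hU⟩ := h.2.1
  exact hU.canon hT

theorem memAC2_zero (hT : 0 ≤ T) : MemAC2 T (fun _ _ => 0) := by
  have hr : ∀ S : ℝ, Rep S (fun _ => 0) (fun _ => 0) := fun S => ⟨MemLp.zero, by simp⟩
  exact Rep2.memAC2 hT (a := fun _ => 0) (b := fun _ => 0) (c := fun _ => 0)
      ⟨hr 1, hr T, MemLp.zero, by simp⟩

/-- The space `W(Ω)` as a linear space of functions. -/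
def WSub (T : ℝ) [Fact (0 < T)] : Submodule ℝ (ℝ → ℝ → ℝ) where
  carrier := {u | MemW T u}
  add_mem' := fun {u v} hu hv => by
    have hJ := (hu.jet pos).add (hv.jet pos)
    have h0 : (0 : ℝ) ∈ Icc 0 T := ⟨le_rfl, pos.le⟩
    refine ⟨fun x t h => by simp [hu.1 x t h, hv.1 x t h], ⟨_, hJ⟩,
      (hu.2.2.1.add pos.le hv.2.2.1).congr pos.le fun x hx t ht =>
        hJ.pd_eq pos le_rfl le_rfl x hx t ht,
      fun x hx => by simp [hu.2.2.2.1 x hx, hv.2.2.2.1 x hx], fun x hx => ?_,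
      fun t ht => by simp [hu.2.2.2.2.2.1 t ht, hv.2.2.2.2.2.1 t ht],
      fun t ht => by simp [hu.2.2.2.2.2.2 t ht, hv.2.2.2.2.2.2 t ht]⟩
    have := hJ.pd_eq pos (i := 0) (j := 1) (by simp) (by simp) x hx 0 h0
    refine this.trans ?_
    have e1 : pd T u 0 1 x 0 = 0 := hu.2.2.2.2.1 x hx
    have e2 : pd T v 0 1 x 0 = 0 := hv.2.2.2.2.1 x hx
    rw [e1, e2, add_zero]
  zero_mem' := by
    have hJ : IsJet T 0 (fun _ _ _ _ => 0) := ⟨fun x _ t _ => rfl,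
      fun i _ j _ x _ t _ => hasDerivWithinAt_const x _ (0 : ℝ),
      fun i _ j _ x _ t _ => hasDerivWithinAt_const t _ (0 : ℝ)⟩
    have h0 : (0 : ℝ) ∈ Icc 0 T := ⟨le_rfl, pos.le⟩
    exact ⟨fun _ _ _ => rfl, ⟨_, hJ⟩, (memAC2_zero pos.le).congr pos.le fun x hx t ht =>
        hJ.pd_eq pos le_rfl le_rfl x hx t ht, fun _ _ => rfl,
      fun x hx => hJ.pd_eq pos (i := 0) (j := 1) (by simp) (by simp) x hx 0 h0,
      fun _ _ => rfl, fun _ _ => rfl⟩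
  smul_mem' := fun r u hu => by
    have hJ := (hu.jet pos).smul r
    have h0 : (0 : ℝ) ∈ Icc 0 T := ⟨le_rfl, pos.le⟩
    refine ⟨fun x t h => by simp [hu.1 x t h], ⟨_, hJ⟩,
      (hu.2.2.1.smul pos.le r).congr pos.le fun x hx t ht =>
        hJ.pd_eq pos le_rfl le_rfl x hx t ht,
      fun x hx => by simp [hu.2.2.2.1 x hx], fun x hx => ?_,
      fun t ht => by simp [hu.2.2.2.2.2.1 t ht],
      fun t ht => by simp [hu.2.2.2.2.2.2 t ht]⟩
    have := hJ.pd_eq pos (i := 0) (j := 1) (by simp) (by simp) x hx 0 h0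
    refine this.trans ?_
    have e1 : pd T u 0 1 x 0 = 0 := hu.2.2.2.2.1 x hx
    rw [e1, mul_zero]

/-- The space `W(Ω)` as a type of its own; it carries the norm topology of `innerW`. -/
def W (T : ℝ) [Fact (0 < T)] : Type := WSub T

variable [Fact (0 < T)]

instance : AddCommGroup (W T) := inferInstanceAs (AddCommGroup (WSub T))
instance : Module ℝ (W T) := inferInstanceAs (Module ℝ (WSub T))
/-- The underlying function. -/
def W.fn (f : W T) : ℝ → ℝ → ℝ := f.1
instance : CoeFun (W T) (fun _ => ℝ → ℝ → ℝ) := ⟨W.fn⟩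

theorem zmemT : (0 : ℝ) ∈ Icc (0 : ℝ) T := ⟨le_rfl, pos.le⟩

theorem W.jet (u : W T) : IsJet T u (pd T u) := MemW.jet pos u.2

theorem W.pd_add (u v : W T) {i j : ℕ} (hi : i ≤ 2) (hj : j ≤ 2) {x t : ℝ}
    (hx : x ∈ Icc (0 : ℝ) 1) (ht : t ∈ Icc 0 T) :
    pd T (u + v : W T) i j x t = pd T u i j x t + pd T v i j x t :=
  (u.jet.add v.jet).pd_eq pos hi hj x hx t ht

theorem W.pd_smul (r : ℝ) (u : W T) {i j : ℕ} (hi : i ≤ 2) (hj : j ≤ 2) {x t : ℝ}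
    (hx : x ∈ Icc (0 : ℝ) 1) (ht : t ∈ Icc 0 T) :
    pd T (r • u : W T) i j x t = r * pd T u i j x t :=
  (u.jet.smul r).pd_eq pos hi hj x hx t ht

theorem W.ext {f g : W T} (h : ∀ x ∈ Icc (0 : ℝ) 1, ∀ t ∈ Icc 0 T, f x t = g x t) : f = g := by
  apply Subtype.ext
  funext x t
  by_cases hx : (x, t) ∈ Omega T
  · exact h x hx.1 t hx.2
  · exact (f.2.1 x t hx).trans (g.2.1 x t hx).symm

/-! structure of elements of W -/

theorem ftc {S : ℝ} {F G : ℝ → ℝ} (h : ∀ x ∈ Icc 0 S, HasDerivWithinAt F (G x) (Icc 0 S) x)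
    (hG : ContinuousOn G (Icc 0 S)) {x : ℝ} (hx : x ∈ Icc 0 S) :
    F x = F 0 + ∫ y in (0 : ℝ)..x, G y := by
  have h1 : ∫ y in (0 : ℝ)..x, G y = F x - F 0 := by
    refine intervalIntegral.integral_eq_sub_of_hasDerivAt_of_le hx.1 ?_ ?_
      (intInt (memLp_cont hG) hx)
    · exact fun y hy => ((h y ⟨hy.1, hy.2.trans hx.2⟩).continuousWithinAt).mono
        (Icc_subset_Icc_right hx.2)
    · exact fun y hy => (h y ⟨hy.1.le, hy.2.le.trans hx.2⟩).hasDerivAt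
        (Icc_mem_nhds hy.1 (hy.2.trans_le hx.2))
  linarith

theorem deriv_zero {S : ℝ} (hS : 0 < S) {F : ℝ → ℝ} {d x : ℝ} (hx : x ∈ Icc 0 S)
    (h : HasDerivWithinAt F d (Icc 0 S) x) (hF : ∀ y ∈ Icc 0 S, F y = 0) : d = 0 := by
  have h2 : HasDerivWithinAt F 0 (Icc 0 S) x :=
    (hasDerivWithinAt_const x _ (0 : ℝ)).congr hF (hF x hx)
  exact (uniqueDiffOn_Icc hS x hx).eq_deriv _ h h2

section structureLemmas
variable (u : W T)

theorem W.bc_x0 {x : ℝ} (hx : x ∈ Icc (0 : ℝ) 1) : pd T u 0 0 x 0 = 0 := u.2.2.2.2.1 x hx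
theorem W.bc_dt {x : ℝ} (hx : x ∈ Icc (0 : ℝ) 1) : pd T u 0 1 x 0 = 0 := u.2.2.2.2.2.1 x hx
theorem W.bc_0t {t : ℝ} (ht : t ∈ Icc 0 T) : pd T u 0 0 0 t = 0 := u.2.2.2.2.2.2.1 t ht
theorem W.bc_1t {t : ℝ} (ht : t ∈ Icc 0 T) : pd T u 0 0 1 t = 0 := u.2.2.2.2.2.2.2 t ht

theorem W.pd_side {a : ℝ} (ha : a ∈ Icc (0 : ℝ) 1) (h : ∀ t ∈ Icc 0 T, pd T u 0 0 a t = 0)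
    {j : ℕ} (hj : j ≤ 2) : ∀ t ∈ Icc 0 T, pd T u 0 j a t = 0 := by
  induction j with
  | zero => exact h
  | succ j ih =>
    intro t ht
    exact deriv_zero pos ht (u.jet.hasDeriv_t 0 (by simp) j (by omega) a ha t ht) (ih (by omega))

theorem W.pd_bot {j : ℕ} (hj : j ≤ 1) {i : ℕ} (hi : i ≤ 2) :
    ∀ x ∈ Icc (0 : ℝ) 1, pd T u i j x 0 = 0 := by
  induction i with
  | zero =>
    intro x hx
    interval_cases j
    · exact u.bc_x0 hx
    · exact u.bc_dt hx
  | succ i ih =>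
    intro x hx
    exact deriv_zero one_pos hx (u.jet.hasDeriv_x i (by omega) j (by omega) x hx 0 zmemT)
      (ih (by omega))

theorem W.memAC2 : MemAC2 T (pd T u 2 2) := u.2.2.2.1

theorem W.w_slice_x {x : ℝ} (hx : x ∈ Icc (0 : ℝ) 1) : ContinuousOn (pd T u 2 2 x) (Icc 0 T) :=
  u.memAC2.rep.slice_x pos.le hx

theorem W.w_slice_t {t : ℝ} (ht : t ∈ Icc 0 T) :
    ContinuousOn (fun x => pd T u 2 2 x t) (Icc 0 1) :=
  u.memAC2.rep.slice_t pos.le ht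

theorem W.s12 {x t : ℝ} (hx : x ∈ Icc (0 : ℝ) 1) (ht : t ∈ Icc 0 T) :
    pd T u 1 2 x t = pd T u 1 2 0 t + ∫ y in (0 : ℝ)..x, pd T u 2 2 y t :=
  ftc (F := fun x => pd T u 1 2 x t)
    (fun y hy => u.jet.hasDeriv_x 1 (by simp) 2 le_rfl y hy t ht) (u.w_slice_t ht) hx

theorem W.s02 {x t : ℝ} (hx : x ∈ Icc (0 : ℝ) 1) (ht : t ∈ Icc 0 T) :
    pd T u 0 2 x t = x * pd T u 1 2 0 t +
      ∫ y in (0 : ℝ)..x, ∫ z in (0 : ℝ)..y, pd T u 2 2 z t := by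
  have hc : ContinuousOn (fun x => pd T u 1 2 x t) (Icc 0 1) := fun y hy =>
    (u.jet.hasDeriv_x 1 (by simp) 2 le_rfl y hy t ht).continuousWithinAt
  have h1 := ftc (F := fun x => pd T u 0 2 x t)
    (fun y hy => u.jet.hasDeriv_x 0 (by simp) 2 le_rfl y hy t ht) hc hx
  have h0 : pd T u 0 2 0 t = 0 := u.pd_side zmem1 (fun t ht => u.bc_0t ht) le_rfl t ht
  simp only [h0, zero_add] at h1
  rw [h1]
  have h2 : ∫ y in (0 : ℝ)..x, pd T u 1 2 y t = ∫ y in (0 : ℝ)..x,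
      (pd T u 1 2 0 t + ∫ z in (0 : ℝ)..y, pd T u 2 2 z t) := by
    refine intervalIntegral.integral_congr fun y hy => ?_
    rw [uIcc_of_le hx.1] at hy
    exact u.s12 ⟨hy.1, hy.2.trans hx.2⟩ ht
  have hc2 : ContinuousOn (fun y => ∫ z in (0 : ℝ)..y, pd T u 2 2 z t) (Icc 0 1) := by
    refine (hc.sub (continuousOn_const (c := pd T u 1 2 0 t))).congr fun y hy => ?_
    simp only [Pi.sub_apply]
    rw [u.s12 hy ht]; ring
  rw [h2, intervalIntegral.integral_add intervalIntegrable_const (intInt (memLp_cont hc2) hx)]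
  simp

theorem W.s_p {t : ℝ} (ht : t ∈ Icc 0 T) : pd T u 1 2 0 t =
    - ∫ y in (0 : ℝ)..1, ∫ z in (0 : ℝ)..y, pd T u 2 2 z t := by
  have h1 := u.s02 omem1 ht
  rw [u.pd_side omem1 (fun t ht => u.bc_1t ht) le_rfl t ht] at h1
  linarith

theorem W.s20 {x t : ℝ} (hx : x ∈ Icc (0 : ℝ) 1) (ht : t ∈ Icc 0 T) :
    pd T u 2 0 x t = ∫ s in (0 : ℝ)..t, ∫ r in (0 : ℝ)..s, pd T u 2 2 x r := by
  have h21 : ∀ s ∈ Icc 0 T, pd T u 2 1 x s = ∫ r in (0 : ℝ)..s, pd T u 2 2 x r := fun s hs => by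
    have := ftc (fun s hs => u.jet.hasDeriv_t 2 le_rfl 1 (by simp) x hx s hs) (u.w_slice_x hx) hs
    rwa [u.pd_bot le_rfl le_rfl x hx, zero_add] at this
  have hc : ContinuousOn (pd T u 2 1 x) (Icc 0 T) := fun s hs =>
    (u.jet.hasDeriv_t 2 le_rfl 1 (by simp) x hx s hs).continuousWithinAt
  have := ftc (fun s hs => u.jet.hasDeriv_t 2 le_rfl 0 (by simp) x hx s hs) hc ht
  rw [u.pd_bot (by simp) le_rfl x hx, zero_add] at this
  rw [this]
  refine intervalIntegral.integral_congr fun s hs => ?_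
  rw [uIcc_of_le ht.1] at hs
  exact h21 s ⟨hs.1, hs.2.trans ht.2⟩

theorem W.eq_zero (h : ∀ x ∈ Icc (0 : ℝ) 1, ∀ t ∈ Icc 0 T, pd T u 2 2 x t = 0) : u = 0 := by
  have hint : ∀ t ∈ Icc 0 T, ∀ x ∈ Icc (0 : ℝ) 1,
      ∫ y in (0 : ℝ)..x, ∫ z in (0 : ℝ)..y, pd T u 2 2 z t = 0 := fun t ht x hx => by
    rw [intervalIntegral.integral_congr (g := fun _ => 0), intervalIntegral.integral_zero]
    intro y hy
    rw [uIcc_of_le hx.1] at hy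
    beta_reduce
    rw [intervalIntegral.integral_congr (g := fun _ => 0), intervalIntegral.integral_zero]
    intro z hz
    rw [uIcc_of_le hy.1] at hz
    exact h z ⟨hz.1, hz.2.trans (hy.2.trans hx.2)⟩ t ht
  have h02 : ∀ x ∈ Icc (0 : ℝ) 1, ∀ t ∈ Icc 0 T, pd T u 0 2 x t = 0 := fun x hx t ht => by
    rw [u.s02 hx ht, u.s_p ht, hint t ht 1 omem1, hint t ht x hx]; simp
  have h01 : ∀ x ∈ Icc (0 : ℝ) 1, ∀ t ∈ Icc 0 T, pd T u 0 1 x t = 0 := fun x hx t ht => by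
    have := ftc (G := fun _ => 0) (fun s hs => by
      have := u.jet.hasDeriv_t 0 (by simp) 1 (by simp) x hx s hs
      rwa [h02 x hx s hs] at this) continuousOn_const ht
    rw [this, u.bc_dt hx]; simp
  refine W.ext fun x hx t ht => ?_
  have := ftc (G := fun _ => 0) (fun s hs => by
      have := u.jet.hasDeriv_t 0 (by simp) 0 (by simp) x hx s hs
      rwa [h01 x hx s hs] at this) continuousOn_const ht
  rw [u.bc_x0 hx] at this
  have e : pd T u 0 0 x t = 0 := by simpa using this
  exact e

end structureLemmas

/-- Auxiliary: `u ↦ ∂⁴u/∂x²∂t²` from `W(Ω)` to `Ŵ(Ω)`. -/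
def W.D : W T →ₗ[ℝ] WHat T where
  toFun u := WHat.mk' (pd T u 2 2) u.memAC2
  map_add' u v := WHat.ext fun x hx t ht => by
    rw [WHat.mk'_apply hx ht, W.pd_add u v le_rfl le_rfl hx ht]
    exact (congrArg₂ (· + ·) (WHat.mk'_apply hx ht) (WHat.mk'_apply hx ht)).symm
  map_smul' r u := WHat.ext fun x hx t ht => by
    rw [WHat.mk'_apply hx ht, W.pd_smul r u le_rfl le_rfl hx ht]
    exact (congrArg (r * ·) (WHat.mk'_apply hx ht)).symm

theorem W.D_apply (u : W T) {x t : ℝ} (hx : x ∈ Icc (0 : ℝ) 1) (ht : t ∈ Icc 0 T) :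
    W.D u x t = pd T u 2 2 x t := WHat.mk'_apply (hf := u.memAC2) hx ht

end

section

variable {T : ℝ} [Fact (0 < T)]

theorem deriv_congr_Ioo {S : ℝ} {f f' : ℝ → ℝ} (h : ∀ x ∈ Icc 0 S, f x = f' x) {x : ℝ}
    (hx : x ∈ Ioo 0 S) : deriv f x = deriv f' x := by
  refine Filter.EventuallyEq.deriv_eq ?_
  filter_upwards [Ioo_mem_nhds hx.1 hx.2] with y hy
  exact h y (Ioo_subset_Icc_self hy)

theorem int_deriv_congr {S : ℝ} (hS : 0 ≤ S) {f f' g g' : ℝ → ℝ} (h : ∀ x ∈ Icc 0 S, f x = f' x)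
    (h' : ∀ x ∈ Icc 0 S, g x = g' x) :
    ∫ x in (0 : ℝ)..S, deriv f x * deriv g x = ∫ x in (0 : ℝ)..S, deriv f' x * deriv g' x := by
  rw [intervalIntegral.integral_of_le hS, intervalIntegral.integral_of_le hS,
    integral_Ioc_eq_integral_Ioo, integral_Ioc_eq_integral_Ioo]
  refine setIntegral_congr_fun measurableSet_Ioo fun x hx => ?_
  simp only [deriv_congr_Ioo h hx, deriv_congr_Ioo h' hx]

theorem int_deriv_zero {S : ℝ} (hS : 0 ≤ S) {f g : ℝ → ℝ} (h : ∀ x ∈ Icc 0 S, f x = 0) :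
    ∫ x in (0 : ℝ)..S, deriv f x * deriv g x = 0 := by
  rw [int_deriv_congr hS (f' := fun _ => 0) (g' := g) h (fun _ _ => rfl)]
  simp

theorem dW_zero {f : ℝ → ℝ} (h : ∀ x ∈ Icc (0 : ℝ) 1, f x = 0) :
    ∀ x ∈ Icc (0 : ℝ) 1, derivWithin f (Icc 0 1) x = 0 := fun x hx =>
  ((hasDerivWithinAt_const x _ (0 : ℝ)).congr h (h x hx)).derivWithin
    (uniqueDiffOn_Icc one_pos x hx)

theorem innerW23_zero {f g : ℝ → ℝ} (h : ∀ x ∈ Icc (0 : ℝ) 1, f x = 0) : innerW23 f g = 0 := by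
  have h1 := dW_zero h
  have h2 := dW_zero h1
  simp only [innerW23]
  rw [h 0 zmem1, h1 0 zmem1, h1 1 omem1, int_deriv_zero zero_le_one h2]
  ring

theorem D_rep (u : W T) : Rep2 T (pd T u 2 2) (deriv fun x => W.D u x 0) (deriv (W.D u 0))
    (dxt T (W.D u)) :=
  (W.D u).rep.congr pos.le fun _ hx _ ht => (W.D_apply u hx ht).symm

theorem innerW_eq0 (u g : W T) : innerW T u g =
    (∫ t in (0 : ℝ)..T, deriv (pd T u 1 2 0) t * deriv (pd T g 1 2 0) t)
    + (pd T u 1 2 0 0 * pd T g 1 2 0 0 + (pd T u 1 2 1 0 * pd T g 1 2 1 0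
    + inner ℝ (jet0 (W.D u)) (jet0 (W.D g)))) := by
  have hi : ∀ i ≤ 2, ∫ t in (0 : ℝ)..T,
      deriv ((dt T)^[2] (dx^[i] u) 0) t * deriv ((dt T)^[2] (dx^[i] g) 0) t =
      ∫ t in (0 : ℝ)..T, deriv (pd T u i 2 0) t * deriv (pd T g i 2 0) t := fun i hi =>
    int_deriv_congr pos.le (fun t ht => u.jet.pd_eq' pos hi le_rfl 0 zmem1 t ht)
      (fun t ht => g.jet.pd_eq' pos hi le_rfl 0 zmem1 t ht)
  have i0 : ∫ t in (0 : ℝ)..T, deriv (pd T u 0 2 0) t * deriv (pd T g 0 2 0) t = 0 :=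
    int_deriv_zero pos.le (u.pd_side zmem1 (fun t ht => u.bc_0t ht) le_rfl)
  have i2 : ∫ t in (0 : ℝ)..T, deriv (pd T u 2 2 0) t * deriv (pd T g 2 2 0) t =
      ∫ t in (0 : ℝ)..T, deriv (W.D u 0) t * deriv (W.D g 0) t :=
    int_deriv_congr pos.le (fun t ht => (W.D_apply u zmem1 ht).symm)
      (fun t ht => (W.D_apply g zmem1 ht).symm)
  have j0 : innerW23 (fun x => (dt T)^[0] u x 0) (fun x => (dt T)^[0] g x 0) = 0 :=
    innerW23_zero fun x hx => u.bc_x0 hx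
  have j1 : innerW23 (fun x => (dt T)^[1] u x 0) (fun x => (dt T)^[1] g x 0) = 0 :=
    innerW23_zero fun x hx => u.bc_dt hx
  have j2 : innerW23 (fun x => (dt T)^[2] u x 0) (fun x => (dt T)^[2] g x 0) =
      pd T u 0 2 0 0 * pd T g 0 2 0 0 + pd T u 1 2 0 0 * pd T g 1 2 0 0
      + pd T u 1 2 1 0 * pd T g 1 2 1 0 +
      ∫ x in (0 : ℝ)..1, deriv (fun x => pd T u 2 2 x 0) x * deriv (fun x => pd T g 2 2 x 0) x := rfl
  have j2' : ∫ x in (0 : ℝ)..1, deriv (fun x => pd T u 2 2 x 0) x * deriv (fun x => pd T g 2 2 x 0) x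
      = ∫ x in (0 : ℝ)..1, deriv (fun x => W.D u x 0) x * deriv (fun x => W.D g x 0) x :=
    int_deriv_congr zero_le_one (fun x hx => (W.D_apply u hx zmemT).symm)
      (fun x hx => (W.D_apply g hx zmemT).symm)
  have k : ∫ x in (0 : ℝ)..1, ∫ t in (0 : ℝ)..T,
      dxt T (dx^[2] ((dt T)^[2] u)) (x, t) * dxt T (dx^[2] ((dt T)^[2] g)) (x, t) =
      ∫ x in (0 : ℝ)..1, ∫ t in (0 : ℝ)..T, dxt T (W.D u) (x, t) * dxt T (W.D g) (x, t) := by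
    have e1 := (D_rep u).dxt pos.le
    have e2 := (D_rep g).dxt pos.le
    rw [dbl_full (c := fun z => dxt T (dx^[2] ((dt T)^[2] u)) z * dxt T (dx^[2] ((dt T)^[2] g)) z)
      pos.le (u.memAC2.rep.rc.1.integrable_mul g.memAC2.rep.rc.1),
      dbl_full (c := fun z => dxt T (W.D u) z * dxt T (W.D g) z)
      pos.le ((W.D u).rep.rc.1.integrable_mul (W.D g).rep.rc.1)]
    refine integral_congr_ae ?_
    filter_upwards [e1, e2] with z h1 h2
    exact congrArg₂ (· * ·) h1 h2
  have z0 : pd T u 0 2 0 0 = 0 := u.pd_side zmem1 (fun t ht => u.bc_0t ht) le_rfl 0 zmemT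
  rw [innerW, k, inner_jet0]
  simp only [Finset.sum_range_succ, Finset.sum_range_zero, j0, j1, j2, j2', hi 0 (by simp),
    hi 1 (by simp), hi 2 le_rfl, i0, i2, z0]
  ring

theorem p_rep (u : W T) : Rep T (pd T u 1 2 0) (deriv (pd T u 1 2 0)) := by
  obtain ⟨q, hq⟩ := rep_trace (memAC2_Vx pos.le (memAC2_Vx pos.le u.memAC2))
  have h := (hq.smul (-1)).congr (f' := pd T u 1 2 0) fun t ht => by
    rw [u.s_p ht]; ring
  exact (h.memW21 pos.le).1.rep

/-- Auxiliary: `∂⁴u/∂t³∂x(0,·)` as an element of `L²[0,T]`. -/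
def pLp : W T →ₗ[ℝ] L2 T where
  toFun u := (p_rep u).1.toLp _
  map_add' u v := by
    have h : Rep T (pd T (u + v : W T) 1 2 0) _ := ((p_rep u).add (p_rep v)).congr fun t ht =>
      W.pd_add u v (by simp) le_rfl zmem1 ht
    rw [← MemLp.toLp_add]
    exact MemLp.toLp_congr _ h.1 (h.memW21 pos.le).2
  map_smul' r u := by
    have h : Rep T (pd T (r • u : W T) 1 2 0) _ := ((p_rep u).smul r).congr fun t ht =>
      W.pd_smul r u (by simp) le_rfl zmem1 ht
    rw [RingHom.id_apply, ← MemLp.toLp_const_smul]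
    exact MemLp.toLp_congr _ h.1 (h.memW21 pos.le).2

/-- Auxiliary: `∂³u/∂t²∂x(x,0)`. -/
def evd (x : ℝ) (hx : x ∈ Icc (0 : ℝ) 1) : W T →ₗ[ℝ] ℝ where
  toFun u := pd T u 1 2 x 0
  map_add' u v := W.pd_add u v (by simp) le_rfl hx zmemT
  map_smul' r u := W.pd_smul r u (by simp) le_rfl hx zmemT

abbrev EW (T : ℝ) : Type := WithLp 2 (L2 T × WithLp 2 (ℝ × WithLp 2 (ℝ × E0 T)))

/-- Auxiliary: all the derivatives that occur in the norm of `W(Ω)`. -/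
def jetW : W T →ₗ[ℝ] EW T :=
  (WithLp.linearEquiv 2 ℝ _).symm.toLinearMap ∘ₗ pLp.prod
    ((WithLp.linearEquiv 2 ℝ _).symm.toLinearMap ∘ₗ (evd 0 zmem1).prod
      ((WithLp.linearEquiv 2 ℝ _).symm.toLinearMap ∘ₗ (evd 1 omem1).prod (jet0 ∘ₗ W.D)))

theorem jetW_apply (u : W T) : jetW u = WithLp.toLp 2 (pLp u, WithLp.toLp 2 (pd T u 1 2 0 0,
    WithLp.toLp 2 (pd T u 1 2 1 0, jet0 (W.D u)))) := rfl

theorem innerW_eq (u g : W T) : innerW T u g = inner ℝ (jetW u) (jetW g) := by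
  rw [innerW_eq0, jetW_apply, jetW_apply]
  simp only [WithLp.prod_inner_apply]
  have : inner ℝ (pLp u) (pLp g) = _ := inner_toLp_int pos.le (p_rep u).1 (p_rep g).1
  rw [this]
  simp [mul_comm]

theorem s12_10 (u : W T) : pd T u 1 2 1 0 = pd T u 1 2 0 0 + W.D u 0 0 +
    ∫ x in (0 : ℝ)..1, (W.D u x 0 - W.D u 0 0) := by
  have hc : ContinuousOn (fun x => W.D u x 0) (Icc 0 1) := (W.D u).rep.slice_t pos.le zmemT
  rw [intervalIntegral.integral_sub (intInt (memLp_cont hc) omem1) intervalIntegrable_const,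
    u.s12 omem1 zmemT]
  have : ∫ x in (0 : ℝ)..1, W.D u x 0 = ∫ x in (0 : ℝ)..1, pd T u 2 2 x 0 := by
    refine intervalIntegral.integral_congr fun y hy => ?_
    rw [uIcc_of_le zero_le_one] at hy
    exact W.D_apply u hy zmemT
  rw [this]
  simp

theorem jetW_inj (u : W T) (h : jetW u = 0) : u = 0 := by
  have h0 : pd T u 1 2 0 0 = 0 := congrArg (fun e : EW T => e.ofLp.2.ofLp.1) h
  have h1 : pd T u 1 2 1 0 = 0 := congrArg (fun e : EW T => e.ofLp.2.ofLp.2.ofLp.1) h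
  have h2 : jet0 (W.D u) = 0 := congrArg (fun e : EW T => e.ofLp.2.ofLp.2.ofLp.2) h
  have h3 := s12_10 u
  have h4 : ∫ x in (0 : ℝ)..1, (W.D u x 0 - W.D u 0 0) = 0 := by
    rw [intervalIntegral.integral_congr (g := fun _ => 0), intervalIntegral.integral_zero]
    intro y hy
    rw [uIcc_of_le zero_le_one] at hy
    exact sub_eq_zero.2 (jet0_zero h2 hy zmemT)
  rw [h0, h1, h4] at h3
  refine u.eq_zero fun x hx t ht => ?_
  rw [← W.D_apply u hx ht, jet0_zero h2 hx ht]
  linarith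

@[reducible] def coreW : InnerProductSpace.Core ℝ (W T) :=
  coreOf (fun f g => innerW T f g) jetW jetW_inj innerW_eq

instance : NormedAddCommGroup (W T) := (coreW (T := T)).toNormedAddCommGroup
instance : InnerProductSpace ℝ (W T) := InnerProductSpace.ofCore (coreW (T := T)).toCore

theorem W.inner_eq (f g : W T) : inner ℝ f g = innerW T f g := rfl

theorem norm_jetW (f : W T) : ‖jetW f‖ = ‖f‖ := by
  rw [@norm_eq_sqrt_real_inner _ _ _ f, @norm_eq_sqrt_real_inner _ _ _ (jetW f),
    W.inner_eq, innerW_eq]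

theorem prod_norm_le {E F : Type*} [NormedAddCommGroup E] [NormedAddCommGroup F]
    (x : WithLp 2 (E × F)) : ‖x‖ ≤ ‖x.ofLp.1‖ + ‖x.ofLp.2‖ := by
  rw [WithLp.prod_norm_eq_of_L2]
  refine Real.sqrt_le_iff.2 ⟨by positivity, ?_⟩
  have h1 := mul_nonneg (norm_nonneg x.ofLp.1) (norm_nonneg x.ofLp.2)
  change ‖x.ofLp.1‖ ^ 2 + ‖x.ofLp.2‖ ^ 2 ≤ _
  nlinarith

theorem D_bound : ∃ C : ℝ, ∀ u : W T, ‖W.D u‖ ≤ C * ‖u‖ := by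
  refine ⟨3 + (volume.restrict (Icc (0 : ℝ) 1)).real univ ^ (1 / 2 : ℝ), fun u => ?_⟩
  set K := (volume.restrict (Icc (0 : ℝ) 1)).real univ ^ (1 / 2 : ℝ) with hK
  have hK0 : 0 ≤ K := by positivity
  have e1 : ‖(jetW u).ofLp.2‖ ≤ ‖u‖ := norm_jetW u ▸ norm_snd_le (jetW u)
  have e2 : ‖(jetW u).ofLp.2.ofLp.2‖ ≤ ‖u‖ := (norm_snd_le (jetW u).ofLp.2).trans e1
  have n0 : |pd T u 1 2 0 0| ≤ ‖u‖ := (norm_fst_le (jetW u).ofLp.2).trans e1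
  have n1 : |pd T u 1 2 1 0| ≤ ‖u‖ := (norm_fst_le (jetW u).ofLp.2.ofLp.2).trans e2
  have nj : ‖jet0 (W.D u)‖ ≤ ‖u‖ := (norm_snd_le (jetW u).ofLp.2.ofLp.2).trans e2
  have na : ‖(W.D u).rep.ra.1.toLp _‖ ≤ ‖u‖ := (norm_fst_le (jet0 (W.D u))).trans nj
  have n3 : |∫ x in (0 : ℝ)..1, (W.D u x 0 - W.D u 0 0)| ≤ K * ‖u‖ := by
    have := intervalIntegral.norm_integral_le_of_norm_le_const (a := 0) (b := 1)
      (f := fun x => W.D u x 0 - W.D u 0 0) (C := K * ‖u‖) (fun x hx => by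
        rw [uIoc_of_le zero_le_one] at hx
        have hx' := Ioc_subset_Icc_self hx
        have h1 := (W.D u).rep.ra.2 x hx'
        have h2 := (abs_int_le (W.D u).rep.ra.1 hx').trans (mul_le_mul_of_nonneg_left na hK0)
        rw [Real.norm_eq_abs]
        refine le_trans (le_of_eq ?_) h2
        congr 1
        exact sub_eq_iff_eq_add'.2 h1)
    simpa using this
  have h3 := s12_10 u
  have n4 : |W.D u 0 0| ≤ (2 + K) * ‖u‖ := by
    rw [abs_le] at *
    constructor <;> nlinarith
  rw [← norm_jetHat]
  refine (prod_norm_le _).trans ?_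
  have : ‖(jetHat (W.D u)).ofLp.1‖ = |W.D u 0 0| := rfl
  have h5 : (jetHat (W.D u)).ofLp.2 = jet0 (W.D u) := rfl
  rw [this, h5]
  linarith

end

section

variable {T : ℝ}

/-- Auxiliary: joint continuity. -/
def Cont2 (f : ℝ → ℝ → ℝ) : Prop := Continuous (fun p : ℝ × ℝ => f p.1 p.2)
/-- Auxiliary: primitive in `t`. -/
def Vt (f : ℝ → ℝ → ℝ) : ℝ → ℝ → ℝ := fun x t => ∫ s in (0 : ℝ)..t, f x s
/-- Auxiliary: primitive in `x`. -/
def Vx (f : ℝ → ℝ → ℝ) : ℝ → ℝ → ℝ := fun x t => ∫ y in (0 : ℝ)..x, f y t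

theorem Cont2.t {f : ℝ → ℝ → ℝ} (h : Cont2 f) (x : ℝ) : Continuous (f x) :=
  Continuous.comp (g := fun p : ℝ × ℝ => f p.1 p.2) h (Continuous.prodMk_right x)
theorem Cont2.x {f : ℝ → ℝ → ℝ} (h : Cont2 f) (t : ℝ) : Continuous (fun x => f x t) :=
  Continuous.comp (g := fun p : ℝ × ℝ => f p.1 p.2) h (Continuous.prodMk_left t)

theorem Cont2.Vt {f : ℝ → ℝ → ℝ} (h : Cont2 f) : Cont2 (Vt f) :=
  intervalIntegral.continuous_parametric_intervalIntegral_of_continuous (μ := volume)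
    (f := fun (p : ℝ × ℝ) s => f p.1 s)
    (Continuous.comp (g := fun p : ℝ × ℝ => f p.1 p.2)
      (f := fun q : (ℝ × ℝ) × ℝ => (q.1.1, q.2)) h (by fun_prop)) continuous_snd

theorem Cont2.Vx {f : ℝ → ℝ → ℝ} (h : Cont2 f) : Cont2 (Vx f) :=
  intervalIntegral.continuous_parametric_intervalIntegral_of_continuous (μ := volume)
    (f := fun (p : ℝ × ℝ) s => f s p.2)
    (Continuous.comp (g := fun p : ℝ × ℝ => f p.1 p.2)
      (f := fun q : (ℝ × ℝ) × ℝ => (q.2, q.1.2)) h (by fun_prop)) continuous_fst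

theorem Cont2.Vt_deriv {f : ℝ → ℝ → ℝ} (h : Cont2 f) (x t : ℝ) :
    HasDerivAt (SGK.Vt f x) (f x t) t :=
  intervalIntegral.integral_hasDerivAt_right ((h.t x).intervalIntegrable _ _)
    ((h.t x).stronglyMeasurableAtFilter _ _) (h.t x).continuousAt

theorem Cont2.Vx_deriv {f : ℝ → ℝ → ℝ} (h : Cont2 f) (x t : ℝ) :
    HasDerivAt (fun y => SGK.Vx f y t) (f x t) x :=
  intervalIntegral.integral_hasDerivAt_right ((h.x t).intervalIntegrable _ _)
    ((h.x t).stronglyMeasurableAtFilter _ _) (h.x t).continuousAt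

/-- Auxiliary: `f` is a primitive of `g` in `x`. -/
def Prim (T : ℝ) (f g : ℝ → ℝ → ℝ) : Prop :=
  ∀ x ∈ Icc (0 : ℝ) 1, ∀ t ∈ Icc 0 T, f x t = f 0 t + ∫ y in (0 : ℝ)..x, g y t

theorem Prim.deriv {f g : ℝ → ℝ → ℝ} (h : Prim T f g) (hg : Cont2 g) {x t : ℝ}
    (hx : x ∈ Icc (0 : ℝ) 1) (ht : t ∈ Icc 0 T) :
    HasDerivWithinAt (fun y => f y t) (g x t) (Icc 0 1) x :=
  ((hg.Vx_deriv x t).const_add (f 0 t)).hasDerivWithinAt.congr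
    (fun y hy => h y hy t ht) (h x hx t ht)

theorem Prim.Vt {f g : ℝ → ℝ → ℝ} (h : Prim T f g) (hf : Cont2 f) (hg : Cont2 g) :
    Prim T (Vt f) (Vt g) := by
  intro x hx t ht
  have hi : IntegrableOn (fun z : ℝ × ℝ => g z.1 z.2) (Omega T) :=
    Continuous.continuousOn hg |>.integrableOn_compact (isCompact_Icc.prod isCompact_Icc)
  have h1 := swap_int hi hx ht
  have h2 : ∫ s in (0 : ℝ)..t, f x s = ∫ s in (0 : ℝ)..t, (f 0 s + ∫ y in (0 : ℝ)..x, g y s) := by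
    refine intervalIntegral.integral_congr fun s hs => ?_
    rw [uIcc_of_le ht.1] at hs
    exact h x hx s ⟨hs.1, hs.2.trans ht.2⟩
  have h3 : Continuous (fun s => ∫ y in (0 : ℝ)..x, g y s) := hg.Vx.t x
  simp only [SGK.Vt]
  rw [h2, intervalIntegral.integral_add ((hf.t 0).intervalIntegrable _ _)
    (h3.intervalIntegrable _ _), h1]

theorem dt_off {u : ℝ → ℝ → ℝ} (h : ∀ x t, (x, t) ∉ Omega T → u x t = 0) :
    ∀ x t, (x, t) ∉ Omega T → dt T u x t = 0 := by
  intro x t hxt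
  by_cases hx : x ∈ Icc (0 : ℝ) 1
  · refine derivWithin_zero_of_notMem_closure ?_
    rw [isClosed_Icc.closure_eq]
    exact fun ht => hxt ⟨hx, ht⟩
  · have : u x = fun _ => 0 := funext fun s => h x s fun h' => hx h'.1
    simp [dt, this]

theorem dx_off {u : ℝ → ℝ → ℝ} (h : ∀ x t, (x, t) ∉ Omega T → u x t = 0) :
    ∀ x t, (x, t) ∉ Omega T → dx u x t = 0 := by
  intro x t hxt
  by_cases ht : t ∈ Icc 0 T
  · refine derivWithin_zero_of_notMem_closure ?_
    rw [isClosed_Icc.closure_eq]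
    exact fun hx => hxt ⟨hx, ht⟩
  · have : (fun y => u y t) = fun _ => 0 := funext fun s => h s t fun h' => ht h'.2
    simp [dx, this]

variable [Fact (0 < T)]

theorem D_surj (w : WHat T) : ∃ u : W T, W.D u = w := by
  classical
  have hT : 0 ≤ T := pos.le
  set wc : ℝ → ℝ → ℝ := fun x t => w (projIcc 0 1 zero_le_one x) (projIcc 0 T hT t) with hwc
  have hc : Cont2 wc := by
    have h1 := w.rep.continuousOn hT
    refine h1.comp_continuous (f := fun p : ℝ × ℝ =>
      ((projIcc 0 1 zero_le_one p.1 : ℝ), (projIcc 0 T hT p.2 : ℝ))) ?_ fun p => ⟨?_, ?_⟩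
    · exact (continuous_subtype_val.comp (continuous_projIcc.comp continuous_fst)).prodMk
        (continuous_subtype_val.comp (continuous_projIcc.comp continuous_snd))
    · exact Subtype.coe_prop _
    · exact Subtype.coe_prop _
  have hw : ∀ x ∈ Icc (0 : ℝ) 1, ∀ t ∈ Icc 0 T, wc x t = w x t := fun x hx t ht => by
    simp only [hwc]
    rw [projIcc_of_mem _ hx, projIcc_of_mem _ ht]
  set p : ℝ → ℝ := fun t => - Vx (Vx wc) 1 t with hp
  have hpc : Continuous p := (hc.Vx.Vx.t 1).neg
  set A0 : ℝ → ℝ → ℝ := fun x t => Vx (Vx wc) x t + x * p t with hA0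
  set A1 : ℝ → ℝ → ℝ := fun x t => Vx wc x t + p t with hA1
  have c0 : Cont2 A0 := Continuous.add hc.Vx.Vx (by fun_prop)
  have c1 : Cont2 A1 := Continuous.add hc.Vx (by fun_prop)
  have p1 : Prim T A1 wc := fun x hx t ht => by simp [hA1, Vx, add_comm]
  have p0 : Prim T A0 A1 := fun x hx t ht => by
    simp only [hA0, hA1]
    rw [intervalIntegral.integral_add ((hc.Vx.x t).intervalIntegrable _ _)
      intervalIntegrable_const]
    simp [Vx]
  let A : ℕ → ℝ → ℝ → ℝ := fun i => if i = 0 then A0 else if i = 1 then A1 else wc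
  let U : ℕ → ℕ → ℝ → ℝ → ℝ := fun i j => Vt^[2 - j] (A i)
  have cA : ∀ i, Cont2 (A i) := fun i => by
    simp only [A]; split_ifs <;> assumption
  have cU : ∀ i j, Cont2 (U i j) := fun i j => by
    simp only [U]
    induction (2 - j) with
    | zero => exact cA i
    | succ n ih => rw [Function.iterate_succ_apply']; exact ih.Vt
  have pA : ∀ i < 2, Prim T (A i) (A (i + 1)) := fun i hi => by
    interval_cases i
    · exact p0
    · exact p1
  have pU : ∀ i < 2, ∀ j, Prim T (U i j) (U (i + 1) j) := fun i hi j => by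
    have : ∀ n, Prim T (Vt^[n] (A i)) (Vt^[n] (A (i + 1))) ∧ Cont2 (Vt^[n] (A i)) ∧
        Cont2 (Vt^[n] (A (i + 1))) := fun n => by
      induction n with
      | zero => exact ⟨pA i hi, cA i, cA (i + 1)⟩
      | succ n ih =>
        simp only [Function.iterate_succ_apply']
        exact ⟨ih.1.Vt ih.2.1 ih.2.2, ih.2.1.Vt, ih.2.2.Vt⟩
    exact (this _).1
  have hU : ∀ i, ∀ j < 2, U i j = Vt (U i (j + 1)) := fun i j hj => by
    simp only [U]
    rw [← Function.iterate_succ_apply' Vt]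
    congr 1; omega
  set u : ℝ → ℝ → ℝ := fun x t => if (x, t) ∈ Omega T then U 0 0 x t else 0 with hu
  have hu0 : ∀ x ∈ Icc (0 : ℝ) 1, ∀ t ∈ Icc 0 T, u x t = U 0 0 x t := fun x hx t ht =>
    if_pos (show (x, t) ∈ Omega T from ⟨hx, ht⟩)
  have hJ : IsJet T u U := by
    refine ⟨fun x hx t ht => (hu0 x hx t ht).symm,
      fun i hi j _ x hx t ht => (pU i hi j).deriv (cU _ _) hx ht, fun i _ j hj x hx t ht => ?_⟩
    rw [hU i j hj]
    exact ((cU i (j + 1)).Vt_deriv x t).hasDerivWithinAt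
  have side : ∀ a t, (∀ t, A0 a t = 0) → U 0 0 a t = 0 := fun a t h => by
    have e : U 0 0 a t = Vt (Vt A0) a t := rfl
    rw [e]
    simp [Vt, h]
  have hmem : MemW T u := by
    refine ⟨fun x t h => if_neg h, ⟨U, hJ⟩, ?_, fun x hx => ?_, fun x hx => ?_,
      fun t ht => ?_, fun t ht => ?_⟩
    · refine MemAC2.congr hT w.2.2 fun x hx t ht => ?_
      exact (hJ.pd_eq pos le_rfl le_rfl x hx t ht).trans (hw x hx t ht)
    · rw [hu0 x hx 0 zmemT, hU 0 0 (by simp)]; simp [Vt]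
    · refine (hJ.pd_eq pos (i := 0) (j := 1) (by simp) (by simp) x hx 0 zmemT).trans ?_
      rw [hU 0 1 (by simp)]; simp [Vt]
    · rw [hu0 0 zmem1 t ht]
      exact side 0 t fun s => by simp [hA0, Vx]
    · rw [hu0 1 omem1 t ht]
      exact side 1 t fun s => by simp [hA0, hp]
  refine ⟨⟨u, hmem⟩, WHat.ext fun x hx t ht => ?_⟩
  refine (W.D_apply _ hx ht).trans ?_
  exact (hJ.pd_eq pos le_rfl le_rfl x hx t ht).trans (hw x hx t ht)

/-! bounds -/

theorem int_bound {x C : ℝ} {f : ℝ → ℝ} (hx : 0 ≤ x)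
    (h : ∀ y ∈ Icc 0 x, |f y| ≤ C) : |∫ y in (0 : ℝ)..x, f y| ≤ C * x := by
  have := intervalIntegral.norm_integral_le_of_norm_le_const (a := 0) (b := x)
      (f := f) (C := C) (fun y hy => by
        rw [uIoc_of_le hx] at hy
        exact h y (Ioc_subset_Icc_self hy))
  simpa [abs_of_nonneg hx] using this

theorem bounds {u : W T} {C : ℝ} (hC : 0 ≤ C)
    (h : ∀ x ∈ Icc (0 : ℝ) 1, ∀ t ∈ Icc 0 T, |pd T u 2 2 x t| ≤ C)
    {x t : ℝ} (hx : x ∈ Icc (0 : ℝ) 1) (ht : t ∈ Icc 0 T) :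
    |pd T u 1 2 x t| ≤ 2 * C ∧ |pd T u 0 2 x t| ≤ 2 * C ∧ |pd T u 2 0 x t| ≤ C * T * T := by
  have i1 : ∀ y ∈ Icc (0 : ℝ) 1, |∫ z in (0 : ℝ)..y, pd T u 2 2 z t| ≤ C := fun y hy =>
    (int_bound hy.1 fun z hz => h z ⟨hz.1, hz.2.trans hy.2⟩ t ht).trans
      (mul_le_of_le_one_right hC hy.2)
  have i2 : ∀ y ∈ Icc (0 : ℝ) 1,
      |∫ y in (0 : ℝ)..y, ∫ z in (0 : ℝ)..y, pd T u 2 2 z t| ≤ C := fun y hy =>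
    (int_bound hy.1 fun z hz => i1 z ⟨hz.1, hz.2.trans hy.2⟩).trans
      (mul_le_of_le_one_right hC hy.2)
  have hp : |pd T u 1 2 0 t| ≤ C := by rw [u.s_p ht, abs_neg]; exact i2 1 omem1
  refine ⟨?_, ?_, ?_⟩
  · rw [u.s12 hx ht]
    refine (abs_add_le _ _).trans ?_
    linarith [i1 x hx]
  · rw [u.s02 hx ht]
    refine (abs_add_le _ _).trans ?_
    rw [abs_mul, abs_of_nonneg hx.1]
    have : x * |pd T u 1 2 0 t| ≤ 1 * C := mul_le_mul hx.2 hp (abs_nonneg _) zero_le_one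
    linarith [i2 x hx]
  · rw [u.s20 hx ht]
    have hT : 0 ≤ T := pos.le
    refine (int_bound (C := C * T) ht.1 fun s hs => ?_).trans
      (mul_le_mul_of_nonneg_left ht.2 (by positivity))
    exact (int_bound hs.1 fun r hr => h x hx r ⟨hr.1, hr.2.trans (hs.2.trans ht.2)⟩).trans
      (mul_le_mul_of_nonneg_left (hs.2.trans ht.2) hC)

theorem pd_bound : ∃ C : ℝ, ∀ u : W T, ∀ x ∈ Icc (0 : ℝ) 1, ∀ t ∈ Icc 0 T,
    |pd T u 1 2 x t| ≤ C * ‖W.D u‖ ∧ |pd T u 0 2 x t| ≤ C * ‖W.D u‖ ∧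
      |pd T u 2 0 x t| ≤ C * ‖W.D u‖ := by
  obtain ⟨C, hC, hb⟩ := WHat.bound (T := T)
  have hT : 0 ≤ T := pos.le
  refine ⟨C * (2 + T * T), fun u x hx t ht => ?_⟩
  have hN := mul_nonneg hC (norm_nonneg (W.D u))
  have := bounds (u := u) hN (fun x hx t ht => by
    rw [← W.D_apply u hx ht]; exact hb _ x hx t ht) hx ht
  have h2 : 0 ≤ C * ‖W.D u‖ * T * T := by positivity
  refine ⟨this.1.trans ?_, this.2.1.trans ?_, this.2.2.trans ?_⟩ <;> nlinarith

theorem pd_sub (u v : W T) {i j : ℕ} (hi : i ≤ 2) (hj : j ≤ 2) {x t : ℝ}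
    (hx : x ∈ Icc (0 : ℝ) 1) (ht : t ∈ Icc 0 T) :
    pd T (u - v : W T) i j x t = pd T u i j x t - pd T v i j x t := by
  have h := W.pd_add (u - v) v hi hj hx ht
  rw [sub_add_cancel] at h
  linarith

theorem tendsto_of_bound {α : ℕ → ℝ} {a C : ℝ} {β : ℕ → ℝ} (h : ∀ n, |α n - a| ≤ C * β n)
    (hβ : Tendsto β atTop (𝓝 0)) : Tendsto α atTop (𝓝 a) := by
  rw [tendsto_iff_norm_sub_tendsto_zero]
  refine squeeze_zero (fun _ => norm_nonneg _) h ?_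
  simpa using hβ.const_mul C

instance : CompleteSpace (W T) := by
  refine Metric.complete_of_cauchySeq_tendsto fun u hu => ?_
  obtain ⟨C, hC⟩ := D_bound (T := T)
  let jW : W T →ₗᵢ[ℝ] EW T := ⟨jetW, norm_jetW⟩
  let DL : W T →L[ℝ] WHat T := LinearMap.mkContinuous W.D C hC
  obtain ⟨e, he⟩ := cauchySeq_tendsto_of_complete
    (jW.isometry.uniformContinuous.comp_cauchySeq hu)
  obtain ⟨w, hw⟩ := cauchySeq_tendsto_of_complete (DL.uniformContinuous.comp_cauchySeq hu)
  have hw : Tendsto (fun n => W.D (u n)) atTop (𝓝 w) := hw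
  have he : Tendsto (fun n => jetW (u n)) atTop (𝓝 e) := he
  obtain ⟨v, rfl⟩ := D_surj w
  obtain ⟨B, hB⟩ := pd_bound (T := T)
  have hD : Tendsto (fun n => ‖W.D (u n - v)‖) atTop (𝓝 0) := by
    simp only [map_sub]; exact tendsto_iff_norm_sub_tendsto_zero.1 hw
  have hpd : ∀ x ∈ Icc (0 : ℝ) 1, ∀ t ∈ Icc 0 T,
      Tendsto (fun n => pd T (u n) 1 2 x t) atTop (𝓝 (pd T v 1 2 x t)) := fun x hx t ht => by
    refine tendsto_of_bound (C := B) (fun n => ?_) hD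
    rw [← pd_sub _ _ (by simp) le_rfl hx ht]
    exact (hB _ x hx t ht).1
  -- the components of the limit
  have cf : Continuous (fun e : EW T => e.ofLp) := WithLp.prod_continuous_ofLp 2 _ _
  have t1 : Tendsto (fun n => pLp (u n)) atTop (𝓝 e.ofLp.1) :=
    ((continuous_fst.comp (WithLp.prod_continuous_ofLp 2 _ _)).tendsto e).comp he
  have t2 : Tendsto (fun n => (jetW (u n)).ofLp.2) atTop (𝓝 e.ofLp.2) :=
    ((continuous_snd.comp (WithLp.prod_continuous_ofLp 2 _ _)).tendsto e).comp he
  have t3 : Tendsto (fun n => pd T (u n) 1 2 0 0) atTop (𝓝 e.ofLp.2.ofLp.1) :=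
    ((continuous_fst.comp (WithLp.prod_continuous_ofLp 2 _ _)).tendsto _).comp t2
  have t4 : Tendsto (fun n => (jetW (u n)).ofLp.2.ofLp.2) atTop (𝓝 e.ofLp.2.ofLp.2) :=
    ((continuous_snd.comp (WithLp.prod_continuous_ofLp 2 _ _)).tendsto _).comp t2
  have t5 : Tendsto (fun n => pd T (u n) 1 2 1 0) atTop (𝓝 e.ofLp.2.ofLp.2.ofLp.1) :=
    ((continuous_fst.comp (WithLp.prod_continuous_ofLp 2 _ _)).tendsto _).comp t4
  have t6 : Tendsto (fun n => jet0 (W.D (u n))) atTop (𝓝 e.ofLp.2.ofLp.2.ofLp.2) :=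
    ((continuous_snd.comp (WithLp.prod_continuous_ofLp 2 _ _)).tendsto _).comp t4
  have e3 : e.ofLp.2.ofLp.1 = pd T v 1 2 0 0 := tendsto_nhds_unique t3 (hpd 0 zmem1 0 zmemT)
  have e5 : e.ofLp.2.ofLp.2.ofLp.1 = pd T v 1 2 1 0 :=
    tendsto_nhds_unique t5 (hpd 1 omem1 0 zmemT)
  have e6 : e.ofLp.2.ofLp.2.ofLp.2 = jet0 (W.D v) := by
    refine tendsto_nhds_unique t6 (tendsto_iff_norm_sub_tendsto_zero.2 ?_)
    refine squeeze_zero (fun _ => norm_nonneg _) (fun n => ?_)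
      (tendsto_iff_norm_sub_tendsto_zero.1 hw)
    rw [← map_sub, ← norm_jetHat]
    exact norm_snd_le (jetHat (W.D (u n) - W.D v))
  have e1 : e.ofLp.1 = pLp v := by
    set q := e.ofLp.1
    have hrep : Rep T (pd T v 1 2 0) q := by
      refine ⟨Lp.memLp q, fun t ht => ?_⟩
      have l1 := hpd 0 zmem1 t ht
      have l2 : Tendsto (fun n => ∫ s in (0 : ℝ)..t, deriv (pd T (u n) 1 2 0) s) atTop
          (𝓝 (∫ s in (0 : ℝ)..t, q s)) := by
        refine tendsto_of_bound
          (C := ((volume.restrict (Icc 0 T)).real univ) ^ (1 / 2 : ℝ)) (fun n => ?_)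
          (tendsto_iff_norm_sub_tendsto_zero.1 t1)
        rw [← intervalIntegral.integral_sub (intInt (p_rep (u n)).1 ht) (intInt (Lp.memLp q) ht)]
        refine (abs_int_le ((p_rep (u n)).1.sub (Lp.memLp q)) ht).trans (le_of_eq ?_)
        rw [MemLp.toLp_sub (p_rep (u n)).1 (Lp.memLp q), Lp.toLp_coeFn]
        rfl
      have l3 := (hpd 0 zmem1 0 zmemT).add l2
      refine tendsto_nhds_unique l1 (l3.congr fun n => ?_)
      exact ((p_rep (u n)).2 t ht).symm
    have := MemLp.toLp_congr (p_rep v).1 (Lp.memLp q) (hrep.memW21 pos.le).2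
    rw [Lp.toLp_coeFn] at this
    exact this.symm
  have hE : e = jetW v := by
    rw [jetW_apply]
    refine WithLp.ofLp_injective 2 (Prod.ext e1 (WithLp.ofLp_injective 2 (Prod.ext e3
      (WithLp.ofLp_injective 2 (Prod.ext e5 e6)))))
  refine ⟨v, tendsto_iff_norm_sub_tendsto_zero.2 ?_⟩
  have := tendsto_iff_norm_sub_tendsto_zero.1 he
  rw [hE] at this
  simpa only [← map_sub, norm_jetW] using this

/-! the operator -/

theorem L_mem (u : W T) :
    (fun x t => (dt T)^[2] u x t - dx^[2] u x t) ∈ WHatSub T := by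
  refine ⟨fun x t h => ?_, ?_⟩
  · have h1 : (dt T)^[2] u x t = 0 := dt_off (dt_off u.2.1) x t h
    have h2 : dx^[2] u x t = 0 := dx_off (dx_off u.2.1) x t h
    beta_reduce
    rw [h1, h2, sub_zero]
  · have m1 := memAC2_xp pos.le (p_rep u)
    have m2 := memAC2_Vx pos.le (memAC2_Vx pos.le u.memAC2)
    have m3 := memAC2_Vt pos.le (memAC2_Vt pos.le u.memAC2)
    refine ((m1.add pos.le m2).add pos.le (m3.smul pos.le (-1))).congr pos.le fun x hx t ht => ?_
    have h1 : (dt T)^[2] u x t = _ := u.s02 hx ht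
    have h2 : dx^[2] u x t = _ := u.s20 hx ht
    rw [h1, h2]; ring

/-- The linear operator `L u = ∂²u/∂t² - ∂²u/∂x²` from `W(Ω)` to `Ŵ(Ω)`. -/
def Llin : W T →ₗ[ℝ] WHat T where
  toFun u := ⟨fun x t => (dt T)^[2] u x t - dx^[2] u x t, L_mem u⟩
  map_add' u v := WHat.ext fun x hx t ht => by
    have h1 := W.pd_add u v (i := 0) (j := 2) (by simp) le_rfl hx ht
    have h2 := W.pd_add u v (i := 2) (j := 0) le_rfl (by simp) hx ht
    change pd T (u + v : W T) 0 2 x t - pd T (u + v : W T) 2 0 x t =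
      (pd T u 0 2 x t - pd T u 2 0 x t) + (pd T v 0 2 x t - pd T v 2 0 x t)
    rw [h1, h2]; ring
  map_smul' r u := WHat.ext fun x hx t ht => by
    have h1 := W.pd_smul r u (i := 0) (j := 2) (by simp) le_rfl hx ht
    have h2 := W.pd_smul r u (i := 2) (j := 0) le_rfl (by simp) hx ht
    change pd T (r • u : W T) 0 2 x t - pd T (r • u : W T) 2 0 x t =
      r * (pd T u 0 2 x t - pd T u 2 0 x t)
    rw [h1, h2]; ring

theorem L_cont : Continuous (Llin (T := T)) := by
  refine LinearMap.continuous_of_seq_closed_graph _ fun u v f hu hf => ?_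
  obtain ⟨C, hC⟩ := D_bound (T := T)
  obtain ⟨B, hB⟩ := pd_bound (T := T)
  obtain ⟨A, _, hA⟩ := WHat.bound (T := T)
  have hD : Tendsto (fun n => ‖W.D (u n - v)‖) atTop (𝓝 0) :=
    squeeze_zero (fun _ => norm_nonneg _) (fun n => hC _)
      (by simpa using (tendsto_iff_norm_sub_tendsto_zero.1 hu).const_mul C)
  refine WHat.ext fun x hx t ht => ?_
  have l1 : Tendsto (fun n => Llin (u n) x t) atTop (𝓝 (f x t)) := by
    refine tendsto_of_bound (C := A) (fun n => ?_) (tendsto_iff_norm_sub_tendsto_zero.1 hf)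
    exact hA (Llin (u n) - f) x hx t ht
  have l2 : Tendsto (fun n => pd T (u n) 0 2 x t) atTop (𝓝 (pd T v 0 2 x t)) := by
    refine tendsto_of_bound (C := B) (fun n => ?_) hD
    rw [← pd_sub _ _ (by simp) le_rfl hx ht]
    exact (hB _ x hx t ht).2.1
  have l3 : Tendsto (fun n => pd T (u n) 2 0 x t) atTop (𝓝 (pd T v 2 0 x t)) := by
    refine tendsto_of_bound (C := B) (fun n => ?_) hD
    rw [← pd_sub _ _ le_rfl (by simp) hx ht]
    exact (hB _ x hx t ht).2.2
  exact tendsto_nhds_unique l1 (l2.sub l3)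

/-- The bounded linear operator `L u = ∂²u/∂t² - ∂²u/∂x²` from `W(Ω)` to `Ŵ(Ω)`. -/
def L : W T →L[ℝ] WHat T := ⟨Llin, L_cont⟩

/-! kernel -/

/-- The reproducing kernel `Q_y(x)` of `W_2^1[0,1]`, given by the same formula as the kernel `q_s(t)`
of `W_2^1[0,T]`. -/
def kerOne (y x : ℝ) : ℝ := if x ≤ y then 1 + x else 1 + y

theorem kerOne_memW21 (S y : ℝ) : MemW21 S (kerOne y) := by
  have h : kerOne y = fun x => 1 + min x y := by
    funext x
    by_cases hx : x ≤ y
    · simp [kerOne, hx]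
    · simp [kerOne, hx, (not_le.1 hx).le]
  have hl : LipschitzWith 1 (kerOne y) := by
    rw [h]
    refine LipschitzWith.of_dist_le_mul fun a b => ?_
    simpa [Real.dist_eq] using abs_min_sub_min_le_max a y b y
  refine ⟨hl.lipschitzOnWith.absolutelyContinuousOnInterval, ?_⟩
  refine MemLp.of_bound (measurable_deriv _).aestronglyMeasurable 1
    (Eventually.of_forall fun x => ?_)
  simpa using norm_deriv_le_of_lipschitz hl (x₀ := x)

theorem memAC2_mul {k l : ℝ → ℝ} (hk : MemW21 1 k) (hl : MemW21 T l) :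
    MemAC2 T (fun x t => k x * l t) := by
  have hT : 0 ≤ T := pos.le
  have hm : MemLp (fun z : ℝ × ℝ => deriv k z.1 * deriv l z.2) 2 (volume.restrict (Omega T)) := by
    rw [restrict_Omega]
    have h1 := (hk.2.comp_fst (res T)).1.mul (hl.2.comp_snd (res 1)).1
    refine (memLp_two_iff_integrable_sq h1).2 ?_
    simp only [Pi.mul_apply, mul_pow]
    exact hk.2.integrable_sq.mul_prod hl.2.integrable_sq
  refine Rep2.memAC2 hT (a := fun x => l 0 * deriv k x) (b := fun t => k 0 * deriv l t)
    ⟨(hk.rep.smul (l 0)).congr fun x _ => mul_comm _ _, hl.rep.smul (k 0), hm,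
      fun x hx t ht => ?_⟩
  simp only [intervalIntegral.integral_const_mul, intervalIntegral.integral_mul_const]
  have h1 := hk.rep.2 x hx
  have h2 := hl.rep.2 t ht
  rw [h1, h2]; ring

/-- The reproducing kernel `G_{(y,s)}(x,t) = Q_y(x) q_s(t)` of `Ŵ(Ω)`. -/
def kernel (T : ℝ) [Fact (0 < T)] (y s : ℝ) : WHat T :=
  WHat.mk' (fun x t => kerOne y x * kerOne s t)
    (memAC2_mul (kerOne_memW21 1 y) (kerOne_memW21 T s))

/-- `Ψ_i = L* G_{(x_i,t_i)}`. -/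
def Psi (T : ℝ) [Fact (0 < T)] (p : ℕ → ℝ × ℝ) (i : ℕ) : W T :=
  ContinuousLinearMap.adjoint L (kernel T (p i).1 (p i).2)

/-- The Gram-Schmidt orthonormalisation of `(Ψ_i)`. Where `Ψ_i` depends linearly on its
predecessors (for instance for a repeated point, or for a corner with `t_i = 0`, where `Ψ_i = 0`),
`PsiHat T p i = 0`. -/
def PsiHat (T : ℝ) [Fact (0 < T)] (p : ℕ → ℝ × ℝ) : ℕ → W T :=
  InnerProductSpace.gramSchmidtNormed ℝ (Psi T p)

end

/-- `u ∈ W(Ω)` solves `L u = M(x,t,u(x,t))` on `Ω`; the homogeneous initial and boundary conditions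
`u(x,0) = ∂u/∂t(x,0) = u(0,t) = u(1,t) = 0` are part of `u ∈ W(Ω)`. -/
def IsSolution {T : ℝ} [Fact (0 < T)] (M : ℝ → ℝ → ℝ → ℝ) (u : W T) : Prop :=
  ∀ x ∈ Icc (0 : ℝ) 1, ∀ t ∈ Icc 0 T, L u x t = M x t (u x t)

/-- `β` is a matrix of orthogonalisation coefficients: `Ψ̂_i = ∑_{k ≤ i} β_ik Ψ_k`. -/
def IsCoeff (T : ℝ) [Fact (0 < T)] (p : ℕ → ℝ × ℝ) (β : ℕ → ℕ → ℝ) : Prop :=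
  ∀ i, PsiHat T p i = ∑ k ∈ Finset.range (i + 1), β i k • Psi T p k

/-- `A_i = ∑_{k ≤ i} β_ik M(x_k, t_k, u(x_k, t_k))`. -/
def coeff {T : ℝ} [Fact (0 < T)] (M : ℝ → ℝ → ℝ → ℝ) (p : ℕ → ℝ × ℝ) (β : ℕ → ℕ → ℝ) (u : W T)
    (i : ℕ) : ℝ :=
  ∑ k ∈ Finset.range (i + 1), β i k * M (p k).1 (p k).2 (u (p k).1 (p k).2)

end SGK

end

/-! The series is the Fourier expansion of `u` along an orthonormalised total sequence, and its
coefficients are computable from the right-hand side alone. By the reproducing property of the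
kernel (`inner_kernel`) and the definition of the adjoint, `⟨L* G_{(y,s)}, u⟩ = ⟨G_{(y,s)}, L u⟩ =
(L u)(y,s)` for every `u` in `W(Ω)`. This is `inner_Psi`. For a solution the right-hand side is
`M(y, s, u(y,s))`, so expanding `Ψ̂_i` in the `Ψ_k` turns the Fourier coefficient `⟨Ψ̂_i, u⟩` into
`∑ β_ik M(x_k, t_k, u(x_k, t_k))`. Nothing is needed about `M`, which enters only through its values
along `u`, and any admissible `β` gives the same coefficients.

It remains to see that the `Ψ_i` are total. If `u` is orthogonal to all of them, then `L u` vanishes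
at the nodes; elements of `Ŵ(Ω)` are continuous and the nodes are dense, so `L u = 0` on `Ω`
(`eq_zero_of_inner_Psi`). Then `u = 0` by the energy method for the wave equation with zero initial
and lateral data (`W.energy_eq_zero`, `W.eq_zero_of_L_eq_zero`): the energy `½ ∫ (∂ₜu)² + (∂ₓu)² dx`
is zero at all times, hence `∂ₜu = 0`, hence `u = 0`. The energy argument needs all `∂ₓ^i ∂ₜ^j u`,
`i, j ≤ 2`, to be jointly continuous; this is derived from the complete continuity of `∂ₓ²∂ₜ²u` and
the boundary conditions in `W.memAC2_pd`.

Totality makes the nonzero `Ψ̂_i` a Hilbert basis (`hasSum_gramSchmidtNormed`), which gives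
unconditional convergence in norm. Pointwise convergence follows because evaluation at a point of
`Ω` is a bounded functional on `W(Ω)` (`W.bound`). -/

namespace SGK

/-! ### The reproducing property of the kernel of `Ŵ(Ω)` and its transport by the adjoint of `L`. -/

section Reproducing

/-- The one-dimensional mechanism of reproduction: pairing a density with the derivative of the
kernel, an indicator, cuts the integral off at `y`. Both sides are integrals of `h` over `Ioc 0 y`,
so no integrability of `h` is required. -/
theorem integral_mul_indicator_Iic {S y : ℝ} (hy : y ∈ Icc 0 S) (h : ℝ → ℝ) :
    ∫ t in (0 : ℝ)..S, h t * (Iic y).indicator 1 t = ∫ t in (0 : ℝ)..y, h t := by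
  have e : (fun t => h t * (Iic y).indicator (1 : ℝ → ℝ) t) = (Iic y).indicator h := by
    funext t
    by_cases ht : t ∈ Iic y <;> simp [ht]
  rw [e, intervalIntegral.integral_of_le (hy.1.trans hy.2), intervalIntegral.integral_of_le hy.1,
    setIntegral_indicator measurableSet_Iic, Ioc_inter_Iic, min_eq_right hy.2]

/-- On `[0,S]` the kernel is `1 + min(t, y)`, with slope one up to `y` and slope zero afterwards. An
explicit density is wanted here because `deriv (kerOne y)` agrees with it only almost everywhere. -/
theorem kerOne_rep {S y : ℝ} (hy : 0 ≤ y) : Rep S (kerOne y) ((Iic y).indicator 1) := by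
  refine ⟨(memLp_const (1 : ℝ)).indicator measurableSet_Iic, fun t ht => ?_⟩
  have e : ∫ s in (0 : ℝ)..t, (Iic y).indicator (1 : ℝ → ℝ) s = min t y := by
    rw [intervalIntegral.integral_of_le ht.1, setIntegral_indicator measurableSet_Iic,
      Ioc_inter_Iic, ← intervalIntegral.integral_of_le (le_min ht.1 hy)]
    simp
  rw [e]
  by_cases h : t ≤ y
  · simp [kerOne, h, hy]
  · simp [kerOne, h, hy, (not_le.1 h).le]

/-- Tensor products are completely continuous because the rectangle increment of `k(x) l(t)` factors
into the increments of `k` and `l`. Unlike `memAC2_mul`, this keeps track of chosen densities. -/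
theorem Rep.mul {T : ℝ} {k l a b : ℝ → ℝ} (hk : Rep 1 k a) (hl : Rep T l b) :
    Rep2 T (fun x t => k x * l t) (fun x => l 0 * a x) (fun t => k 0 * b t)
      (fun z => a z.1 * b z.2) := by
  have hm : MemLp (fun z : ℝ × ℝ => a z.1 * b z.2) 2 (volume.restrict (Omega T)) := by
    rw [restrict_Omega]
    have h1 := (hk.1.comp_fst (res T)).1.mul (hl.1.comp_snd (res 1)).1
    -- The square of the tensor product is the tensor product of the squares, each of which is
    -- integrable.
    refine (memLp_two_iff_integrable_sq h1).2 ?_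
    simp only [Pi.mul_apply, mul_pow]
    exact hk.1.integrable_sq.mul_prod hl.1.integrable_sq
  refine ⟨(hk.smul (l 0)).congr fun x _ => mul_comm _ _, hl.smul (k 0), hm, fun x hx t ht => ?_⟩
  simp only [intervalIntegral.integral_const_mul, intervalIntegral.integral_mul_const]
  rw [hk.2 x hx, hl.2 t ht]; ring

variable {T : ℝ} [Fact (0 < T)]

/-- Lets the almost everywhere defined derivatives in `innerHat` be replaced by explicit densities.
-/
theorem integral_mul_congr_ae {S : ℝ} (hS : 0 ≤ S) (h : ℝ → ℝ) {f g : ℝ → ℝ}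
    (e : f =ᵐ[volume.restrict (Icc 0 S)] g) :
    ∫ t in (0 : ℝ)..S, h t * f t = ∫ t in (0 : ℝ)..S, h t * g t := by
  rw [intervalIntegral.integral_of_le hS, intervalIntegral.integral_of_le hS,
    ← integral_Icc_eq_integral_Ioc, ← integral_Icc_eq_integral_Ioc]
  refine integral_congr_ae ?_
  filter_upwards [e] with t ht
  rw [ht]

/-- The inner product of `Ŵ(Ω)` in terms of any densities of the second argument. -/
theorem WHat.inner_eq_of_rep (f g : WHat T) {a b : ℝ → ℝ} {c : ℝ × ℝ → ℝ} (h : Rep2 T g a b c) :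
    inner ℝ f g = (∫ t in (0 : ℝ)..T, deriv (f 0) t * b t)
      + (f 0 0 * g 0 0 + ∫ x in (0 : ℝ)..1, deriv (fun x => f x 0) x * a x)
      + ∫ x in (0 : ℝ)..1, ∫ t in (0 : ℝ)..T, dxt T f (x, t) * c (x, t) := by
  rw [WHat.inner_eq, innerHat, innerW21,
    integral_mul_congr_ae pos.le _ (h.rb.memW21 pos.le).2,
    integral_mul_congr_ae zero_le_one _ (h.ra.memW21 zero_le_one).2]
  congr 1
  -- The mixed derivative is determined only up to null sets of the rectangle, so the iterated
  -- integrals are first rewritten as integrals over `Ω`, where almost everywhere equality can be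
  -- used directly.
  rw [dbl_full (c := fun z => dxt T f z * dxt T g z) pos.le
      (f.rep.rc.1.integrable_mul g.rep.rc.1),
    dbl_full (c := fun z => dxt T f z * c z) pos.le (f.rep.rc.1.integrable_mul h.rc.1)]
  refine integral_congr_ae ?_
  filter_upwards [h.dxt pos.le] with z hz
  rw [hz]

/-- The reproducing property of the kernel. -/
theorem inner_kernel (f : WHat T) {y s : ℝ} (hy : y ∈ Icc (0 : ℝ) 1) (hs : s ∈ Icc 0 T) :
    inner ℝ f (kernel T y s) = f y s := by
  have hR : Rep2 T (kernel T y s) _ _ _ :=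
    ((kerOne_rep hy.1).mul (kerOne_rep hs.1)).congr pos.le fun x hx t ht =>
      WHat.mk'_apply hx ht
  -- The traces of the kernel on the two axes carry the factors `kerOne s 0` and `kerOne y 0`; both
  -- are one, so the densities on the axes are plain indicators.
  have k0 : ∀ z : ℝ, 0 ≤ z → kerOne z 0 = 1 := fun z hz => by simp [kerOne, hz]
  have kk : kernel T y s 0 0 = 1 := by
    rw [kernel, WHat.mk'_apply zmem1 zmemT, k0 y hy.1, k0 s hs.1, one_mul]
  rw [WHat.inner_eq_of_rep f _ hR, kk, k0 y hy.1, k0 s hs.1]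
  simp only [one_mul, mul_one]
  -- The indicator in `x` is constant for the inner integral; with it in front, the `t`-integral is
  -- cut off at `s` and then the `x`-integral at `y`.
  have e : ∀ x t, dxt T f (x, t) * ((Iic y).indicator (1 : ℝ → ℝ) x * (Iic s).indicator 1 t) =
      (Iic y).indicator (1 : ℝ → ℝ) x * (dxt T f (x, t) * (Iic s).indicator 1 t) :=
    fun x t => by ring
  simp only [e, intervalIntegral.integral_const_mul]
  simp only [integral_mul_indicator_Iic hs, mul_comm ((Iic y).indicator (1 : ℝ → ℝ) _)]
  rw [integral_mul_indicator_Iic hy, integral_mul_indicator_Iic hy]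
  -- What is left is `f(0,0) + ∫₀^y a + ∫₀^s b + ∫₀^y ∫₀^s c`, the Carathéodory representation of
  -- `f` at `(y,s)`.
  have h1 := f.rep.ra.2 y hy
  have h2 := f.rep.rb.2 s hs
  have h3 := f.rep.rc.2 y hy s hs
  beta_reduce at h1
  linarith

/-- The adjoint moves `L` onto `u`, and the kernel then evaluates `L u` at the node. Both the
totality of the `Ψ_i` and the formula for the coefficients rest on this. -/
theorem inner_Psi {p : ℕ → ℝ × ℝ} {i : ℕ} (hp : p i ∈ Omega T) (u : W T) :
    inner ℝ (Psi T p i) u = L u (p i).1 (p i).2 := by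
  rw [Psi, ContinuousLinearMap.adjoint_inner_left, real_inner_comm, inner_kernel _ hp.1 hp.2]

end Reproducing

/-! ### Regularity of elements of `W(Ω)`, the energy method, and totality of the `Ψ_i`. -/

section Uniqueness

variable {T : ℝ} [Fact (0 < T)]

/-- A jet component that vanishes at `t = 0` and whose `t`-derivative is completely continuous is
itself completely continuous. -/
theorem W.memAC2_pd_of_succ (u : W T) {i j : ℕ} (hi : i ≤ 2) (hj : j ≤ 1)
    (h : MemAC2 T (pd T u i (j + 1))) : MemAC2 T (pd T u i j) := by
  refine (memAC2_Vt pos.le h).congr pos.le fun x hx t ht => ?_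
  have := ftc (fun s hs => u.jet.hasDeriv_t i hi j (by omega) x hx s hs)
    (h.rep.slice_x pos.le hx) ht
  -- The initial conditions may be differentiated in `x`, so for `j ≤ 1` the constant of integration
  -- at `t = 0` vanishes.
  rwa [u.pd_bot hj hi x hx, zero_add] at this

/-- Since `u(0,t) = 0`, `W.s02` writes `∂ₜ²u` as `x p(t)` plus a double `x`-primitive of `∂ₓ²∂ₜ²u`,
where `p = ∂ₓ∂ₜ²u(0,·)` is absolutely continuous with derivative in `L²` by `p_rep`. -/
theorem W.memAC2_pd_zero_two (u : W T) : MemAC2 T (pd T u 0 2) :=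
  ((memAC2_xp pos.le (p_rep u)).add pos.le
    (memAC2_Vx pos.le (memAC2_Vx pos.le u.memAC2))).congr pos.le fun _ hx _ ht => u.s02 hx ht

theorem W.memAC2_pd_one_two (u : W T) : MemAC2 T (pd T u 1 2) := by
  -- The term `p(t)`, independent of `x`, is treated as the tensor product `1 · p(t)`.
  have h1 : Rep 1 (fun _ => (1 : ℝ)) (fun _ => 0) := ⟨MemLp.zero, by simp⟩
  refine (((h1.mul (p_rep u)).memAC2 pos.le).add pos.le
    (memAC2_Vx pos.le u.memAC2)).congr pos.le fun x hx t ht => ?_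
  rw [u.s12 hx ht, one_mul]

/-- The definition of `W(Ω)` grants complete continuity only at order `(2,2)`. Integrating in `x`
lowers `i` at `j = 2`, and integrating twice in `t` from zero initial data lowers `j`. The joint
continuity obtained in this way justifies Fubini's theorem and the fundamental theorem of calculus
in the energy argument. -/
theorem W.memAC2_pd (u : W T) {i j : ℕ} (hi : i ≤ 2) (hj : j ≤ 2) : MemAC2 T (pd T u i j) := by
  have h2 : MemAC2 T (pd T u i 2) := by
    interval_cases i
    exacts [u.memAC2_pd_zero_two, u.memAC2_pd_one_two, u.memAC2]
  have h1 := u.memAC2_pd_of_succ hi le_rfl h2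
  interval_cases j
  exacts [u.memAC2_pd_of_succ hi zero_le_one h1, h1, h2]

theorem W.continuousOn_pd (u : W T) {i j : ℕ} (hi : i ≤ 2) (hj : j ≤ 2) :
    ContinuousOn (fun p : ℝ × ℝ => pd T u i j p.1 p.2) (Omega T) :=
  (u.memAC2_pd hi hj).rep.continuousOn pos.le

/-- Integration of an exact derivative along the `t`-direction:
`∫₀ᵗ v ∂ₜv = v² / 2` for a jet component `v` that vanishes at `t = 0`. -/
theorem W.integral_pd_mul_pd_succ (u : W T) {i j : ℕ} (hi : i ≤ 2) (hj : j ≤ 1) {x t : ℝ}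
    (hx : x ∈ Icc (0 : ℝ) 1) (ht : t ∈ Icc 0 T) :
    ∫ s in (0 : ℝ)..t, pd T u i j x s * pd T u i (j + 1) x s = pd T u i j x t ^ 2 / 2 := by
  have c0 := (u.memAC2_pd hi (j := j) (by omega)).rep.slice_x pos.le hx
  have c1 := (u.memAC2_pd hi (j := j + 1) (by omega)).rep.slice_x pos.le hx
  have h := ftc (F := fun s => pd T u i j x s ^ 2 / 2)
    (G := fun s => pd T u i j x s * pd T u i (j + 1) x s) (fun s hs => by
      have := ((u.jet.hasDeriv_t i hi j (by omega) x hx s hs).pow 2).div_const 2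
      refine this.congr_deriv ?_
      push_cast; ring) (c0.mul c1) ht
  beta_reduce at h
  rw [u.pd_bot hj hi x hx] at h
  linarith

/-- Integration by parts in `x`; the boundary terms vanish. -/
theorem W.integral_parts (u : W T) {t : ℝ} (ht : t ∈ Icc 0 T) :
    ∫ x in (0 : ℝ)..1, (pd T u 0 1 x t * pd T u 2 0 x t + pd T u 1 0 x t * pd T u 1 1 x t) = 0 := by
  have c : ∀ {i j : ℕ}, i ≤ 2 → j ≤ 2 → ContinuousOn (fun x => pd T u i j x t) (Icc 0 1) :=
    fun hi hj => (u.memAC2_pd hi hj).rep.slice_t pos.le ht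
  -- The integrand is the exact `x`-derivative of the energy flux `∂ₜu ∂ₓu`.
  have h := ftc (F := fun x => pd T u 0 1 x t * pd T u 1 0 x t)
    (G := fun x => pd T u 0 1 x t * pd T u 2 0 x t + pd T u 1 0 x t * pd T u 1 1 x t)
    (fun x hx => by
      have := (u.jet.hasDeriv_x 0 (by simp) 1 (by simp) x hx t ht).mul
        (u.jet.hasDeriv_x 1 (by simp) 0 (by simp) x hx t ht)
      refine this.congr_deriv ?_
      simp only [zero_add, Nat.reduceAdd]; ring)
    (((c (by simp) (by simp)).mul (c (by simp) (by simp))).add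
      ((c (by simp) (by simp)).mul (c (by simp) (by simp)))) omem1
  beta_reduce at h
  -- The flux vanishes at both ends because `∂ₜu` does, the conditions at `x = 0` and `x = 1` being
  -- differentiated in `t`; `∂ₓu` need not vanish there.
  rw [u.pd_side omem1 (fun t ht => u.bc_1t ht) (by simp) t ht,
    u.pd_side zmem1 (fun t ht => u.bc_0t ht) (by simp) t ht] at h
  linarith

/-- The energy `½ ∫ (∂ₜu)² + (∂ₓu)²` of a solution of the homogeneous wave equation is zero. -/
theorem W.energy_eq_zero (u : W T)
    (h : ∀ x ∈ Icc (0 : ℝ) 1, ∀ t ∈ Icc 0 T, pd T u 0 2 x t = pd T u 2 0 x t) {t : ℝ}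
    (ht : t ∈ Icc 0 T) :
    ∫ x in (0 : ℝ)..1, (pd T u 0 1 x t ^ 2 / 2 + pd T u 1 0 x t ^ 2 / 2) = 0 := by
  have c : ∀ {i j : ℕ}, i ≤ 2 → j ≤ 2 →
      ContinuousOn (fun p : ℝ × ℝ => pd T u i j p.1 p.2) (Omega T) := fun hi hj =>
    u.continuousOn_pd hi hj
  have hint : IntegrableOn (fun p : ℝ × ℝ => pd T u 0 1 p.1 p.2 * pd T u 2 0 p.1 p.2
      + pd T u 1 0 p.1 p.2 * pd T u 1 1 p.1 p.2) (Omega T) :=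
    (((c (by simp) (by simp)).mul (c (by simp) (by simp))).add
      ((c (by simp) (by simp)).mul (c (by simp) (by simp)))).integrableOn_compact
        (isCompact_Icc.prod isCompact_Icc)
  -- The divergence of the flux is integrated over `[0,1] × [0,t]` in both orders: integrating first
  -- in `x` gives zero, integrating first in `t` gives the energy at time `t`. This avoids
  -- differentiating the energy under the integral sign.
  have hsw := swap_int hint omem1 ht
  beta_reduce at hsw
  have hz : ∫ s in (0 : ℝ)..t, ∫ x in (0 : ℝ)..1,
      (pd T u 0 1 x s * pd T u 2 0 x s + pd T u 1 0 x s * pd T u 1 1 x s) = 0 := by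
    rw [intervalIntegral.integral_congr (g := fun _ => 0), intervalIntegral.integral_zero]
    intro s hs
    rw [uIcc_of_le ht.1] at hs
    exact u.integral_parts ⟨hs.1, hs.2.trans ht.2⟩
  refine Eq.trans ?_ (hsw.trans hz)
  refine intervalIntegral.integral_congr fun x hx => ?_
  rw [uIcc_of_le zero_le_one] at hx
  have hi : ∀ {i j k l : ℕ}, i ≤ 2 → j ≤ 2 → k ≤ 2 → l ≤ 2 →
      IntervalIntegrable (fun r => pd T u i j x r * pd T u k l x r) volume 0 t :=
    fun hi hj hk hl => intInt (memLp_cont (((u.memAC2_pd hi hj).rep.slice_x pos.le hx).mul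
      ((u.memAC2_pd hk hl).rep.slice_x pos.le hx))) ht
  -- For fixed `x` the energy density at time `t` is the integral over `[0,t]` of its time
  -- derivative `∂ₜu ∂ₜ²u + ∂ₓu ∂ₓ∂ₜu`, both `∂ₜu` and `∂ₓu` being zero at time zero. The wave
  -- equation then turns `∂ₜ²u` into `∂ₓ²u`, which matches the integrand of `hsw`.
  rw [← u.integral_pd_mul_pd_succ (i := 0) (j := 1) (by simp) le_rfl hx ht,
    ← u.integral_pd_mul_pd_succ (i := 1) (j := 0) (by simp) (by simp) hx ht,
    ← intervalIntegral.integral_add (hi (by simp) (by simp) (by simp) (by simp))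
      (hi (by simp) (by simp) (by simp) (by simp))]
  refine intervalIntegral.integral_congr fun r hr => ?_
  rw [uIcc_of_le ht.1] at hr
  rw [h x hx r ⟨hr.1, hr.2.trans ht.2⟩]

/-- Injectivity of `L`: a continuous nonnegative energy density with zero integral is identically
zero, so `∂ₜu = 0`, and `u` vanishes at `t = 0`. -/
theorem W.eq_zero_of_L_eq_zero (u : W T)
    (h : ∀ x ∈ Icc (0 : ℝ) 1, ∀ t ∈ Icc 0 T, L u x t = 0) : u = 0 := by
  have hw : ∀ x ∈ Icc (0 : ℝ) 1, ∀ t ∈ Icc 0 T, pd T u 0 2 x t = pd T u 2 0 x t :=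
    fun x hx t ht => sub_eq_zero.1 (h x hx t ht)
  have hv : ∀ x ∈ Icc (0 : ℝ) 1, ∀ t ∈ Icc 0 T, pd T u 0 1 x t = 0 := fun x hx t ht => by
    have c : ∀ {i j : ℕ}, i ≤ 2 → j ≤ 2 → ContinuousOn (fun x => pd T u i j x t) (Icc 0 1) :=
      fun hi hj => (u.memAC2_pd hi hj).rep.slice_t pos.le ht
    have hc : ContinuousOn (fun x => pd T u 0 1 x t ^ 2 / 2 + pd T u 1 0 x t ^ 2 / 2) (Icc 0 1) :=
      (((c (by simp) (by simp)).pow 2).div_const 2).add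
        (((c (by simp) (by simp)).pow 2).div_const 2)
    have h0 := u.energy_eq_zero hw ht
    rw [intervalIntegral.integral_of_le zero_le_one, ← integral_Icc_eq_integral_Ioc,
      integral_eq_zero_iff_of_nonneg (fun x => by positivity)
        (hc.integrableOn_compact isCompact_Icc)] at h0
    -- Continuity upgrades vanishing almost everywhere to vanishing at every `x`, the endpoints
    -- included.
    have := Measure.eqOn_Icc_of_ae_eq volume zero_ne_one h0 hc continuousOn_const hx
    simp only [Pi.zero_apply] at this
    have h1 := sq_nonneg (pd T u 1 0 x t)
    have h2 := sq_nonneg (pd T u 0 1 x t)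
    exact (pow_eq_zero_iff two_ne_zero).1 (show pd T u 0 1 x t ^ 2 = 0 by linarith)
  refine W.ext fun x hx t ht => ?_
  -- Now `u² / 2 = ∫₀ᵗ u ∂ₜu`, and the integrand is zero.
  have h1 := u.integral_pd_mul_pd_succ (i := 0) (j := 0) (by simp) (by simp) hx ht
  rw [intervalIntegral.integral_congr (g := fun _ => 0), intervalIntegral.integral_zero] at h1
  · have h2 : pd T u 0 0 x t ^ 2 = 0 := by linarith
    exact (pow_eq_zero_iff two_ne_zero).1 h2
  · intro s hs
    rw [uIcc_of_le ht.1] at hs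
    beta_reduce
    rw [hv x hx s ⟨hs.1, hs.2.trans ht.2⟩, mul_zero]

/-- Totality of the `Ψ_i`. Orthogonality says that `L u` vanishes at the nodes; being continuous on
`Ω`, it vanishes on their closure, and `L` is injective. -/
theorem eq_zero_of_inner_Psi {p : ℕ → ℝ × ℝ} (hp : ∀ i, p i ∈ Omega T)
    (hdense : Omega T ⊆ closure (range p)) (u : W T) (h : ∀ i, inner ℝ (Psi T p i) u = 0) :
    u = 0 := by
  refine u.eq_zero_of_L_eq_zero fun x hx t ht => ?_
  have hc := (L u).rep.continuousOn pos.le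
  have hsub : range p ⊆ Omega T := range_subset_iff.2 hp
  have : EqOn (fun q : ℝ × ℝ => L u q.1 q.2) (fun _ => 0) (Omega T) := by
    refine EqOn.of_subset_closure (s := range p) ?_ hc continuousOn_const hsub hdense
    rintro _ ⟨i, rfl⟩
    exact (inner_Psi (hp i) u).symm.trans (h i)
  exact this (show (x, t) ∈ Omega T from ⟨hx, ht⟩)

end Uniqueness

/-! ### Continuity of point evaluation on `W(Ω)`. -/

section Evaluation

variable {T : ℝ} [Fact (0 < T)]

/-- Point evaluation on `W(Ω)` is bounded. -/
theorem W.bound : ∃ C : ℝ, ∀ u : W T, ∀ x ∈ Icc (0 : ℝ) 1, ∀ t ∈ Icc 0 T, |u x t| ≤ C * ‖u‖ := by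
  obtain ⟨C, hC⟩ := D_bound (T := T)
  obtain ⟨B, hB⟩ := pd_bound (T := T)
  have hT : 0 ≤ T := pos.le
  -- `C` bounds `∂ₓ²∂ₜ²u` in `Ŵ(Ω)` by the norm of `u`, `B` then bounds `∂ₜ²u` uniformly, and each
  -- of the two integrations in `t` costs a factor `T`. The absolute value is there because
  -- `pd_bound` does not assert `B ≥ 0`.
  refine ⟨|B| * C * T * T, fun u x hx t ht => ?_⟩
  set K := |B| * (C * ‖u‖)
  have hD : ‖W.D u‖ ≤ C * ‖u‖ := hC u
  have hK : 0 ≤ K := mul_nonneg (abs_nonneg _) ((norm_nonneg _).trans hD)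
  have h2 : ∀ s ∈ Icc 0 T, |pd T u 0 2 x s| ≤ K := fun s hs =>
    (hB u x hx s hs).2.1.trans (mul_le_mul (le_abs_self B) hD (norm_nonneg _) (abs_nonneg _))
  -- One integration in `t` from a zero initial value; it is applied to `∂ₜu` and then to `u`.
  have step : ∀ (j : ℕ), j ≤ 1 → ∀ A : ℝ, 0 ≤ A → (∀ s ∈ Icc 0 T, |pd T u 0 (j + 1) x s| ≤ A) →
      ∀ s ∈ Icc 0 T, |pd T u 0 j x s| ≤ A * T := fun j hj A hA h s hs => by
    have := ftc (fun s hs => u.jet.hasDeriv_t 0 (by simp) j (by omega) x hx s hs)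
      ((u.memAC2_pd (i := 0) (by simp) (by omega)).rep.slice_x pos.le hx) hs
    rw [this, u.pd_bot hj (by simp) x hx, zero_add]
    exact (int_bound hs.1 fun r hr => h r ⟨hr.1, hr.2.trans hs.2⟩).trans
      (mul_le_mul_of_nonneg_left hs.2 hA)
  have h1 := step 1 le_rfl K hK h2
  have h0 := step 0 (by simp) (K * T) (by positivity) h1 t ht
  refine h0.trans (le_of_eq ?_)
  ring

/-- Point evaluation on `W(Ω)` as a continuous linear functional. -/
noncomputable def W.evalCLM (x t : ℝ) (hx : x ∈ Icc (0 : ℝ) 1) (ht : t ∈ Icc 0 T) : W T →L[ℝ] ℝ :=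
  LinearMap.mkContinuous
    { toFun := fun u => u x t
      map_add' := fun _ _ => rfl
      map_smul' := fun _ _ => rfl } (W.bound (T := T)).choose
    fun u => (W.bound (T := T)).choose_spec u x hx t ht

end Evaluation

/-! ### Fourier expansion along the Gram–Schmidt sequence and identification of the coefficients. -/

section Expansion

/-- The expansion of a vector along the Gram-Schmidt orthonormalisation of a total sequence. -/
theorem hasSum_gramSchmidtNormed {E : Type*} [NormedAddCommGroup E] [InnerProductSpace ℝ E]
    [CompleteSpace E] {f : ℕ → E} (hf : ∀ v, (∀ i, inner ℝ (f i) v = 0) → v = 0) (v : E) :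
    HasSum (fun i => (inner ℝ (InnerProductSpace.gramSchmidtNormed ℝ f i) v : ℝ) •
      InnerProductSpace.gramSchmidtNormed ℝ f i) v := by
  set e := InnerProductSpace.gramSchmidtNormed ℝ f with he
  -- Linear dependence among the `f i` produces zero vectors, so only the indices with nonzero `e i`
  -- can carry an orthonormal family.
  have horth : Orthonormal ℝ (fun i : {i | e i ≠ 0} => e i) :=
    InnerProductSpace.gramSchmidtNormed_orthonormal' f
  have hspan : Submodule.span ℝ (range e) = Submodule.span ℝ (range f) :=
    (InnerProductSpace.span_gramSchmidtNormed_range f).trans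
      (InnerProductSpace.span_gramSchmidt ℝ f)
  have hbot : (Submodule.span ℝ (range fun i : {i | e i ≠ 0} => e i))ᗮ = ⊥ := by
    refine (Submodule.eq_bot_iff _).2 fun w hw => hf w fun i => ?_
    -- Restoring the zero vectors does not affect orthogonality, so `w` is orthogonal to the span of
    -- all `e i`. That is the span of the `f i`, and totality applies.
    have hw' : ∀ z ∈ Submodule.span ℝ (range e), inner ℝ z w = 0 := by
      intro z hz
      induction hz using Submodule.span_induction with
      | mem z hz =>
        obtain ⟨j, rfl⟩ := hz
        by_cases hj : e j = 0
        · rw [hj, inner_zero_left]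
        · exact (Submodule.mem_orthogonal _ _).1 hw _ (Submodule.subset_span ⟨⟨j, hj⟩, rfl⟩)
      | zero => exact inner_zero_left _
      | add a b _ _ ha hb => rw [inner_add_left, ha, hb, add_zero]
      | smul r a _ ha => rw [inner_smul_left, ha, mul_zero]
    exact hw' _ (hspan ▸ Submodule.subset_span ⟨i, rfl⟩)
  have hs := (HilbertBasis.mkOfOrthogonalEqBot horth hbot).hasSum_repr v
  simp only [HilbertBasis.repr_apply_apply, HilbertBasis.coe_mkOfOrthogonalEqBot] at hs
  -- The terms with `e i = 0` vanish, so the sum over the basis indices is the sum over all of `ℕ`.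
  refine (hasSum_subtype_iff_of_support_subset (s := {i | e i ≠ 0}) fun i hi => ?_).1 hs
  intro h0
  exact hi (by simp [h0])

/-- Gram–Schmidt is triangular: each vector lies in the span of `Ψ_0, …, Ψ_i`. If these are linearly
dependent, the coefficients are not unique. -/
theorem exists_isCoeff (T : ℝ) [Fact (0 < T)] (p : ℕ → ℝ × ℝ) : ∃ β, IsCoeff T p β := by
  have h : ∀ i, ∃ c : ℕ → ℝ, ∑ k ∈ Finset.range (i + 1), c k • Psi T p k = PsiHat T p i := by
    intro i
    refine (Submodule.mem_span_image_finset_iff_exists_fun' ℝ).1 ?_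
    have := InnerProductSpace.gramSchmidt_mem_span ℝ (Psi T p) (le_refl i)
    have e : ((Finset.range (i + 1) : Finset ℕ) : Set ℕ) = Iic i := by
      ext k; simp
    rw [e]
    -- Normalisation multiplies by the inverse norm, which is `0` for the zero vector; the
    -- degenerate case therefore needs no separate treatment.
    exact Submodule.smul_mem _ _ this
  choose β hβ using h
  exact ⟨β, fun i => (hβ i).symm⟩

/-- The Fourier coefficient is a combination of the values of `L u` at the first nodes, and there
the equation replaces `L u` by `M`. -/
theorem inner_PsiHat {T : ℝ} [Fact (0 < T)] {M : ℝ → ℝ → ℝ → ℝ} {p : ℕ → ℝ × ℝ}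
    (hp : ∀ i, p i ∈ Omega T) {β : ℕ → ℕ → ℝ} (hβ : IsCoeff T p β) {u : W T}
    (hu : IsSolution M u) (i : ℕ) : inner ℝ (PsiHat T p i) u = coeff M p β u i := by
  rw [hβ i, sum_inner, coeff]
  refine Finset.sum_congr rfl fun k _ => ?_
  rw [real_inner_smul_left, inner_Psi (hp k), hu _ (hp k).1 _ (hp k).2]

end Expansion

end SGK

/-! ### The expansion of a solution. -/

theorem theorem3p2 (T : ℝ) [Fact (0 < T)] (M : ℝ → ℝ → ℝ → ℝ) (p : ℕ → ℝ × ℝ)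
    (hp : ∀ i, p i ∈ SGK.Omega T) (hdense : SGK.Omega T ⊆ closure (Set.range p)) :
    (∃ β : ℕ → ℕ → ℝ, SGK.IsCoeff T p β) ∧
    ∀ β : ℕ → ℕ → ℝ, SGK.IsCoeff T p β → ∀ u : SGK.W T, SGK.IsSolution M u →
      HasSum (fun i => SGK.coeff M p β u i • SGK.PsiHat T p i) u ∧
      (∀ x ∈ Set.Icc (0 : ℝ) 1, ∀ t ∈ Set.Icc 0 T,
        HasSum (fun i => SGK.coeff M p β u i * SGK.PsiHat T p i x t) (u x t)) ∧
      Filter.Tendsto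
        (fun n => ‖(∑ i ∈ Finset.range n, SGK.coeff M p β u i • SGK.PsiHat T p i) - u‖)
        Filter.atTop (nhds 0) := by
  refine ⟨SGK.exists_isCoeff T p, fun β hβ u hu => ?_⟩
  have hs : HasSum (fun i => SGK.coeff M p β u i • SGK.PsiHat T p i) u := by
    have h := SGK.hasSum_gramSchmidtNormed (f := SGK.Psi T p)
      (SGK.eq_zero_of_inner_Psi hp hdense) u
    refine h.congr_fun fun i => ?_
    rw [← SGK.inner_PsiHat hp hβ hu i]
    rfl
  -- A continuous linear functional maps the convergent series in `W(Ω)` to a convergent series of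
  -- values.
  refine ⟨hs, fun x hx t ht => (SGK.W.evalCLM x t hx ht).hasSum hs, ?_⟩
  exact tendsto_iff_norm_sub_tendsto_zero.1 hs.tendsto_sum_nat
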